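/- **Setting.** For even $n$ let $\mathbf{x}^0=(-1,+1,-1,+1,\dots)\in\mathbb{R}^n$ and $$f_\epsilon(\mathbf{x})=\frac{1-\epsilon}{2}\sum_{i=1}^n x_i^2+\frac{\epsilon}{2}\Big(\sum_{i=1}^n x_i\Big)^2,\qquad f_\epsilon^*=\min_{\mathbf{x}} f_\epsilon(\mathbf{x}).$$ For a smooth $f:\mathbb{R}^n\to\mathbb{R}$ let $L_{jk}$ be the least constant with $|\nabla_k f(\mathbf{x}+r\mathbf{e}_j)-\nabla_k f(\mathbf{x})|\le L_{jk}|r|$ for all $\mathbf{x},r$, and let $L_{\max}(f)=\max_j L_{jj}$, $L_{\overline{\mathrm{res}}}(f)=\max_k\big(\sum_j L_{kj}^2\big)^{1/2}$. *Asynchronous stochastic coordinate descent* on $F$ with step-size parameter $\Gamma\ge L_{\max}(F)$, started at $\mathbf{x}^0$: update $\mathcal{U}_t$ starts at global time $t$, selects a coordinate $k_t\in\{1,\dots,n\}$ independently and uniformly at random, reads a vector $\tilde{\mathbf{x}}$ from the shared memory, and, when it commits (at a time $t'+\frac12$ with $t'\ge t$ an integer, distinct updates at distinct times), adds $-\nabla_{k_t}F(\tilde{\mathbf{x}})/\Gamma$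 to coordinate $k_t$. Reads are *inconsistent*: for each coordinate $j$ separately, $\tilde x_j$ may be the value of coordinate $j$ available at time $t$, or any value written to coordinate $j$ by an update committing during the timespan of $\mathcal{U}_t$, before $\mathcal{U}_t$ commits. An *asynchronous schedule* makes these choices (commit times and which values are read); the choices for $\mathcal{U}_t$ may depend on the coordinates selected by the time $\mathcal{U}_t$ commits, but not on later ones. It is *$q$-bounded* if the timespan (from start to commit) of every update overlaps those of at most $q$ other updates. Let $\mathbf{x}^t$ be the memory content after $t$ updates have committed. For $F=L_{\max}f_\epsilon$, put $\alpha=\dfrac{1-\epsilon}{\Gamma/L_{\max}}$ and $\nu=\dfrac{3\epsilon\alpha}{\Gamma/L_{\max}-6\epsilon}$. The run *stalls for $T$ updates* if, for every $t\le T$ and every coordinate $j$, there is an ideal value $v\in\{x^0_j,\;x^0_j(1-\alpha)\}$ such that $x^t_j=v$ or $\frac23\nu\le|x^t_j-v|\le\nu$. **Theorem.** Let $c\ge1$ be real, $0<L_{\max}\le\Gamma$, let $L_{\overline{\mathrm{res}}}$ be real, and let $$\bar q=\Big\lceil \frac{74\,\Gamma\sqrt n}{L_{\overline{\mathrm{res}}}}+96\,c\ln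 n+435\Big\rceil .$$ Suppose that $n$ is even, $n\ge \bar q^2/4$ and $$\frac{37}{2}\cdot\frac{\Gamma}{L_{\max}}<\frac{L_{\overline{\mathrm{res}}}}{L_{\max}}\le\frac1{18}\sqrt{n-1},$$ and put $\epsilon=\sqrt{\dfrac{(L_{\overline{\mathrm{res}}}/L_{\max})^2-1}{n-1}}$. Then the function $L_{\max}f_\epsilon$ has Lipschitz parameters $L_{\max}$ and $L_{\overline{\mathrm{res}}}$, and for every integer $q\ge\bar q$ there is a $q$-bounded asynchronous schedule under inconsistent reads such that stochastic coordinate descent on $L_{\max}f_\epsilon$ started at $\mathbf{x}^0$, run for $\lceil n^c\rceil$ updates, stalls for $\lceil n^c\rceil$ updates with probability at least $1-1/n^c$ over the random choices of coordinates; moreover, for the same schedule and every integer $0\le t\le n^c$, $$\mathbb{E}\big[f_\epsilon(\mathbf{x}^t)-f_\epsilon^*\big]\ \ge\ \tfrac14\big(f_\epsilon(\mathbf{x}^0)-f_\epsilon^*\big).$$ -/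

import Mathlib

noncomputable section

namespace SACD

/-- The partial derivative `∇_j f (x)`. -/
def partialDeriv {n : ℕ} (f : (Fin n → ℝ) → ℝ) (j : Fin n) (x : Fin n → ℝ) : ℝ :=
  fderiv ℝ f x (Pi.single j 1)

/-- The (smallest) Lipschitz parameter `L_{jk}` of `f`: the least `L ≥ 0` with
`|∇_k f (x + r e_j) - ∇_k f (x)| ≤ L |r|` for all `x` and `r`. -/
def coordLip {n : ℕ} (f : (Fin n → ℝ) → ℝ) (j k : Fin n) : ℝ :=
  sInf {L : ℝ | 0 ≤ L ∧ ∀ (x : Fin n → ℝ) (r : ℝ),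
    |partialDeriv f k (x + r • (Pi.single j 1 : Fin n → ℝ)) - partialDeriv f k x| ≤ L * |r|}

/-- `L_max = max_j L_{jj}`. -/
def lipMax {n : ℕ} (f : (Fin n → ℝ) → ℝ) : ℝ := ⨆ j, coordLip f j j

/-- `L̄_res = max_k (∑_j L_{kj}²)^{1/2}`. -/
def lipResBar {n : ℕ} (f : (Fin n → ℝ) → ℝ) : ℝ := ⨆ k, √(∑ j, coordLip f k j ^ 2)

/-- The function `f_ε`. -/
def fEps {n : ℕ} (ε : ℝ) (x : Fin n → ℝ) : ℝ :=
  (1 - ε) / 2 * ∑ i, x i ^ 2 + ε / 2 * (∑ i, x i) ^ 2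

/-- The minimum value `f*` of `f`. -/
def minValue {n : ℕ} (f : (Fin n → ℝ) → ℝ) : ℝ := ⨅ x, f x

/-- The initial point `(-1, +1, -1, +1, …)`. -/
def startPoint (n : ℕ) : Fin n → ℝ := fun i => if Even (i : ℕ) then -1 else 1

/-- An asynchronous schedule, under inconsistent reads, for a run of `T` updates of `n` coordinates.
Its decisions may depend on the sequence `k` of selected coordinates (`k t` is the coordinate
selected by update `t`).  Update `t` starts at global time `t` and commits at global time
`commit k t + 1/2`; no two updates commit at the same time.  While it is being computed, update `t`
reads from the shared memory, for every coordinate `j` separately, the value that coordinate `j` has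
at the integer time `readTime k t j`, which lies between the start and the commit of update `t`;
so it gets either the value available at time `t`, or the value written by any one of the
updates of coordinate `j` that commit during the timespan of update `t`, before its own commit.
The schedule cannot look into the future: the decisions about an update depend only on the
coordinates that have been selected by the time that this update commits. -/
structure Schedule (n T : ℕ) where
  commit : (Fin T → Fin n) → Fin T → ℕ
  readTime : (Fin T → Fin n) → Fin T → Fin n → ℕ
  start_le_commit : ∀ (k : Fin T → Fin n) (t : Fin T), (t : ℕ) ≤ commit k t
  commit_injective : ∀ k, Function.Injective (commit k)
  start_le_readTime : ∀ (k : Fin T → Fin n) (t : Fin T) (j : Fin n), (t : ℕ) ≤ readTime k t j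
  readTime_le_commit : ∀ k t j, readTime k t j ≤ commit k t
  adapted : ∀ (k k' : Fin T → Fin n) (t : Fin T), (∀ s : Fin T, (s : ℕ) ≤ commit k t → k s = k' s) →
    commit k' t = commit k t ∧ readTime k' t = readTime k t

namespace Schedule

variable {n T : ℕ}

/-- The schedule is `q`-bounded: whatever coordinates are selected, the timespan
`[t, commit k t + 1/2]` of every update `t` overlaps the timespans of at most `q` other updates. -/
def IsBounded (S : Schedule n T) (q : ℕ) : Prop :=
  ∀ k t, (Finset.univ.filter fun s : Fin T =>
    s ≠ t ∧ (s : ℕ) ≤ S.commit k t ∧ (t : ℕ) ≤ S.commit k s).card ≤ q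

/-- `S.history F Γ x₀ k r m` is the content of the shared memory at the integer global time `m`,
for `m ≤ r`; see `memory_zero` and `memory_succ`. -/
def history (S : Schedule n T) (F : (Fin n → ℝ) → ℝ) (Γ : ℝ) (x₀ : Fin n → ℝ) (k : Fin T → Fin n) :
    ℕ → ℕ → Fin n → ℝ
  | 0 => fun _ => x₀
  | r + 1 => fun m => if m ≤ r then S.history F Γ x₀ k r m else fun j =>
      S.history F Γ x₀ k r r j -
        ∑ s ∈ Finset.univ.filter (fun s : Fin T => S.commit k s = r ∧ k s = j),
          partialDeriv F j (fun i => S.history F Γ x₀ k r (S.readTime k s i) i) / Γ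

/-- The content of the shared memory at the integer global time `r`, in the run of asynchronous
coordinate descent on `F` with step-size parameter `Γ`, initial point `x₀`, selected
coordinates `k` and schedule `S`. -/
def memory (S : Schedule n T) (F : (Fin n → ℝ) → ℝ) (Γ : ℝ) (x₀ : Fin n → ℝ) (k : Fin T → Fin n)
    (r : ℕ) : Fin n → ℝ :=
  S.history F Γ x₀ k r r

theorem memory_zero (S : Schedule n T) (F : (Fin n → ℝ) → ℝ) (Γ : ℝ) (x₀ : Fin n → ℝ)
    (k : Fin T → Fin n) : S.memory F Γ x₀ k 0 = x₀ := rfl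

theorem history_eq_memory (S : Schedule n T) (F : (Fin n → ℝ) → ℝ) (Γ : ℝ) (x₀ : Fin n → ℝ)
    (k : Fin T → Fin n) (r m : ℕ) (h : m ≤ r) :
    S.history F Γ x₀ k r m = S.memory F Γ x₀ k m := by
  induction r with
  | zero => obtain rfl : m = 0 := by omega
            rfl
  | succ r ih =>
    rcases Nat.lt_or_ge r m with h' | h'
    · obtain rfl : m = r + 1 := by omega
      rfl
    · rw [← ih h']
      simp [history, h']

/-- The update rule: the update `s` that commits between the times `r` and `r + 1`
(there is at most one) adds `-∇_j F (x̃) / Γ` to its coordinate `j = k s`, where `x̃` is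
the vector of the values that it has read. -/
theorem memory_succ (S : Schedule n T) (F : (Fin n → ℝ) → ℝ) (Γ : ℝ) (x₀ : Fin n → ℝ)
    (k : Fin T → Fin n) (r : ℕ) (j : Fin n) :
    S.memory F Γ x₀ k (r + 1) j = S.memory F Γ x₀ k r j -
      ∑ s ∈ Finset.univ.filter (fun s : Fin T => S.commit k s = r ∧ k s = j),
        partialDeriv F j (fun i => S.memory F Γ x₀ k (S.readTime k s i) i) / Γ := by
  have h : ∀ s ∈ Finset.univ.filter (fun s : Fin T => S.commit k s = r ∧ k s = j),
      partialDeriv F j (fun i => S.history F Γ x₀ k r (S.readTime k s i) i) / Γ =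
        partialDeriv F j (fun i => S.memory F Γ x₀ k (S.readTime k s i) i) / Γ := by
    intro s hs
    have hs' := (Finset.mem_filter.mp hs).2.1
    congr 2
    funext i
    rw [S.history_eq_memory F Γ x₀ k r _ (hs' ▸ S.readTime_le_commit k s i)]
  rw [← Finset.sum_congr rfl h]
  simp [memory, history]

/-- The point `x^t`: the content of the memory once `t` updates have committed. -/
def point (S : Schedule n T) (F : (Fin n → ℝ) → ℝ) (Γ : ℝ) (x₀ : Fin n → ℝ) (k : Fin T → Fin n)
    (t : ℕ) : Fin n → ℝ :=
  S.memory F Γ x₀ k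
    (sInf {r : ℕ | t ≤ (Finset.univ.filter fun s : Fin T => S.commit k s < r).card})

end Schedule

/-- The condition of stalling at a point `x`, for `γ = Γ / L_max`, with `α = (1 - ε) / γ` and
`ν = 3 ε α / (γ - 6 ε)`: every coordinate with initial value `1` (resp. `-1`) has
an ideal value `v` in `{1, 1 - α}` (resp. `{-1, -(1 - α)}`), and its actual value either is `v` or
differs from `v` by a value in `±[2ν/3, ν]`. -/
def StalledAt {n : ℕ} (ε γ : ℝ) (x₀ x : Fin n → ℝ) : Prop :=
  let α := (1 - ε) / γ
  let ν := 3 * ε * α / (γ - 6 * ε)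
  ∀ j, ∃ v : ℝ, (v = x₀ j ∨ v = x₀ j * (1 - α)) ∧
    (x j = v ∨ (2 / 3 * ν ≤ |x j - v| ∧ |x j - v| ≤ ν))

/-- The run on `L_max • f_ε`, from `(-1, +1, -1, +1, …)` and with step-size parameter `Γ`, stalls
for `t` updates under the schedule `S` when the selected coordinates are `k`. -/
def StallsFor {n T : ℕ} (S : Schedule n T) (ε Lmax Γ : ℝ) (k : Fin T → Fin n) (t : ℕ) : Prop :=
  ∀ s ≤ t, StalledAt ε (Γ / Lmax) (startPoint n)
    (S.point (fun x => Lmax * fEps ε x) Γ (startPoint n) k s)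

open Classical in
/-- Probability of an event when the `T` coordinates are selected independently and uniformly,
i.e. over the `n ^ T` equally likely sequences. -/
def prob {n T : ℕ} (A : (Fin T → Fin n) → Prop) : ℝ :=
  ((Finset.univ.filter A).card : ℝ) / (n : ℝ) ^ T

/-- Expectation over the `n ^ T` equally likely sequences of selected coordinates. -/
def expect {n T : ℕ} (g : (Fin T → Fin n) → ℝ) : ℝ :=
  (∑ k, g k) / (n : ℝ) ^ T

end SACD

end

/-! ### Derivatives, Lipschitz parameters and extreme values of `f_ε`. -/

namespace SACD

/-! Stale reads let the adversary choose the sum of the vector that an update reads, and hence the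
value it writes. Write `γ = Γ / L_max`. Each coordinate is held near one of two ideal values, `x⁰_j`
and `(1 - α) x⁰_j`; the second is what an exact update at `x⁰` produces. Certain updates are flips,
which move their coordinate to its other ideal value. Flips alternately raise and lower the sum of
the ideal values, which therefore is always `0` or `α`, and a flipped coordinate stays frozen for
the next `a = ⌊q̄/4⌋` updates.

Commits are delayed by `2a` (flips in the first phase by `a`), so an update may read, for every
recently flipped coordinate, either the current value or the one before the flip. Each choice shifts
the written value by about `(ε/γ) α`, with sign given by the direction of the flip. About `7γ/ε`
recent flips provide enough shift in both directions to cancel the correction `α (2 - α)` needed in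
the worst case, and a greedy choice hits any window as long as the largest single shift
(`exists_inBand`).

The deviation from the ideal value is put in `±[2ν/3, ν]`, with sign opposite to the total
deviation, so that the total is driven back to zero. Steering can fail only if the last `a` updates
contain too few flips, or if the total deviation exceeds `Bν`. The first is excluded by an
exponential moment, since every update flips with conditional probability at least `1/2 - a/n`
(`expect_exp_count_le`). For the second, with `z` the total deviation over `ν`, the potential `exp z
+ exp (-z)` grows by at most `exp 2` per update in expectation (`sum_potential_update_le`). Its
value after the first `a` updates is controlled by the number of repeated selections, which are rare
because `4a² ≤ n`. A union bound over all updates finishes the probability estimate.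

For the function values, about half of the coordinates are expected to be unflipped, and each of
these contributes at least `9/16` to `∑ x_i²`. -/

theorem partialDeriv_mul_fEps {n : ℕ} (L ε : ℝ) (j : Fin n) (x : Fin n → ℝ) :
    partialDeriv (fun x : Fin n → ℝ => L * fEps ε x) j x =
      L * ((1 - ε) * x j + ε * ∑ i, x i) := by
  have hp : ∀ i : Fin n, HasFDerivAt (fun x : Fin n → ℝ => x i)
      (ContinuousLinearMap.proj (R := ℝ) (φ := fun _ : Fin n => ℝ) i) x :=
    fun i => (ContinuousLinearMap.proj (R := ℝ) (φ := fun _ : Fin n => ℝ) i).hasFDerivAt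
  have h1 : HasFDerivAt (fun x : Fin n → ℝ => ∑ i, x i ^ 2) _ x :=
    HasFDerivAt.fun_sum (u := Finset.univ) fun i _ => (hp i).pow 2
  have h2 : HasFDerivAt (fun x : Fin n → ℝ => ∑ i, x i) _ x :=
    HasFDerivAt.fun_sum (u := Finset.univ) fun i _ => hp i
  have h3 := (((h1.const_mul ((1 - ε) / 2)).add ((h2.pow 2).const_mul (ε / 2))).const_mul L)
  have h4 : HasFDerivAt (fun x : Fin n → ℝ => L * fEps ε x) _ x := h3
  rw [partialDeriv, h4.fderiv]
  simp [Pi.single_apply, Finset.sum_ite_eq']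
  ring

theorem coordLip_mul_fEps {n : ℕ} (L ε : ℝ) (hL : 0 ≤ L) (hε : 0 ≤ ε) (j k : Fin n) :
    coordLip (fun x : Fin n → ℝ => L * fEps ε x) j k = if j = k then L else L * ε := by
  set C : ℝ := if j = k then L else L * ε with hC
  have hC0 : 0 ≤ C := by rw [hC]; split_ifs <;> positivity
  have key : ∀ (x : Fin n → ℝ) (r : ℝ),
      |partialDeriv (fun x : Fin n → ℝ => L * fEps ε x) k (x + r • (Pi.single j 1 : Fin n → ℝ)) -
        partialDeriv (fun x : Fin n → ℝ => L * fEps ε x) k x| = C * |r| := by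
    intro x r
    rw [partialDeriv_mul_fEps, partialDeriv_mul_fEps]
    have hs : ∑ i, (x + r • (Pi.single j 1 : Fin n → ℝ)) i = ∑ i, x i + r := by
      simp [Finset.sum_add_distrib, Pi.single_apply]
    have hC' : C * |r| = |C * r| := by rw [abs_mul, abs_of_nonneg hC0]
    rw [hs, hC', hC]
    congr 1
    split_ifs with h
    · subst h
      simp
      ring
    · simp [Ne.symm h]
      ring
  have : {M : ℝ | 0 ≤ M ∧ ∀ (x : Fin n → ℝ) (r : ℝ),
      |partialDeriv (fun x : Fin n → ℝ => L * fEps ε x) k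
          (x + r • (Pi.single j 1 : Fin n → ℝ)) -
        partialDeriv (fun x : Fin n → ℝ => L * fEps ε x) k x| ≤ M * |r|} = Set.Ici C := by
    ext M
    simp only [key, Set.mem_ofPred_eq, Set.mem_Ici]
    constructor
    · rintro ⟨_, h⟩
      simpa using h 0 1
    · intro h
      exact ⟨hC0.trans h, fun _ r => mul_le_mul_of_nonneg_right h (abs_nonneg r)⟩
  rw [coordLip, this, csInf_Ici]

theorem lipMax_mul_fEps {n : ℕ} [NeZero n] (L ε : ℝ) (hL : 0 ≤ L) (hε : 0 ≤ ε) :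
    lipMax (fun x : Fin n → ℝ => L * fEps ε x) = L := by
  simp [lipMax, coordLip_mul_fEps L ε hL hε]

theorem lipResBar_mul_fEps {n : ℕ} [NeZero n] (L ε : ℝ) (hL : 0 ≤ L) (hε : 0 ≤ ε) :
    lipResBar (fun x : Fin n → ℝ => L * fEps ε x) = L * √(1 + (n - 1) * ε ^ 2) := by
  have h : ∀ k : Fin n, √(∑ j, coordLip (fun x : Fin n → ℝ => L * fEps ε x) k j ^ 2) =
      L * √(1 + (n - 1) * ε ^ 2) := by
    intro k
    have hs : ∑ j, coordLip (fun x : Fin n → ℝ => L * fEps ε x) k j ^ 2 =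
        L ^ 2 * (1 + (n - 1) * ε ^ 2) := by
      have : ∀ j, coordLip (fun x : Fin n → ℝ => L * fEps ε x) k j ^ 2 =
          (L * ε) ^ 2 + if k = j then L ^ 2 - (L * ε) ^ 2 else 0 := by
        intro j
        rw [coordLip_mul_fEps L ε hL hε]
        split_ifs <;> ring
      simp only [this, Finset.sum_add_distrib, Finset.sum_ite_eq, Finset.sum_const,
        Finset.card_univ, Fintype.card_fin, Finset.mem_univ, if_true, nsmul_eq_mul]
      ring
    rw [hs, Real.sqrt_mul (sq_nonneg L), Real.sqrt_sq hL]
  simp [lipResBar, h]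

theorem fEps_ge {n : ℕ} {ε : ℝ} (hε : 0 ≤ ε) (x : Fin n → ℝ) :
    (1 - ε) / 2 * ∑ i, x i ^ 2 ≤ fEps ε x := by
  rw [fEps]
  have : 0 ≤ ε / 2 * (∑ i, x i) ^ 2 := by positivity
  linarith

theorem fEps_nonneg {n : ℕ} {ε : ℝ} (hε : 0 ≤ ε) (hε1 : ε ≤ 1) (x : Fin n → ℝ) :
    0 ≤ fEps ε x := by
  refine le_trans ?_ (fEps_ge hε x)
  have : 0 ≤ 1 - ε := by linarith
  positivity

theorem minValue_fEps {n : ℕ} {ε : ℝ} (hε : 0 ≤ ε) (hε1 : ε ≤ 1) :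
    minValue (fEps (n := n) ε) = 0 := by
  apply le_antisymm
  · have h : fEps (n := n) ε 0 = 0 := by simp [fEps]
    rw [← h]
    exact ciInf_le ⟨0, by rintro _ ⟨x, rfl⟩; exact fEps_nonneg hε hε1 x⟩ 0
  · exact le_ciInf fun x => fEps_nonneg hε hε1 x

theorem startPoint_sq {n : ℕ} (i : Fin n) : startPoint n i ^ 2 = 1 := by
  unfold startPoint
  split_ifs <;> norm_num

theorem sum_startPoint {n : ℕ} (hn : Even n) : ∑ i, startPoint n i = 0 := by
  obtain ⟨m, rfl⟩ := hn
  simp only [startPoint]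
  rw [Fin.sum_univ_eq_sum_range (fun i => if Even i then (-1 : ℝ) else 1) (m + m)]
  induction m with
  | zero => simp
  | succ m ih =>
    have : m + 1 + (m + 1) = (m + m) + 1 + 1 := by ring
    rw [this, Finset.sum_range_succ, Finset.sum_range_succ, ih]
    simp [parity_simps]

theorem fEps_startPoint {n : ℕ} (hn : Even n) (ε : ℝ) :
    fEps ε (startPoint n) = (1 - ε) / 2 * n := by
  simp [fEps, sum_startPoint hn, startPoint_sq]

end SACD
-- Greedy subset sums and the flipping process.
namespace SACD

/-- Greedy choice: adding terms one at a time, the partial sum cannot jump over a window at least as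
long as the largest step. -/
theorem exists_subset_sum_mem_Icc {ι : Type*} [DecidableEq ι] {lo hi h : ℝ} (hlo : lo + h ≤ hi)
    (δ : ι → ℝ) (s : Finset ι) : (∀ i ∈ s, δ i ≤ h) → ∀ g : ℝ, g ≤ hi → lo ≤ g + ∑ i ∈ s, δ i →
    ∃ Q ⊆ s, lo ≤ g + ∑ i ∈ Q, δ i ∧ g + ∑ i ∈ Q, δ i ≤ hi := by
  induction s using Finset.induction_on with
  | empty => exact fun _ g hg hs => ⟨∅, le_rfl, by simpa using hs, by simpa using hg⟩
  | insert x s hx ih =>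
    intro hδ g hg hs
    by_cases hgl : lo ≤ g
    · exact ⟨∅, by simp, by simpa using hgl, by simpa using hg⟩
    · push Not at hgl
      rw [Finset.sum_insert hx] at hs
      obtain ⟨Q, hQ, h1, h2⟩ := ih (fun i hi => hδ i (Finset.mem_insert_of_mem hi)) (g + δ x)
        (by linarith [hδ x (Finset.mem_insert_self x s)]) (by linarith)
      refine ⟨insert x Q, Finset.insert_subset_insert x hQ, ?_⟩
      rw [Finset.sum_insert fun h => hx (hQ h)]
      constructor <;> linarith

/-- From any starting value, steps of size at most `h`, upwards over `U` and downwards over `D`,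
reach every interval of length `h` that is not too far away. -/
theorem exists_subset_sum_mem_Icc_of_abs {ι : Type*} [DecidableEq ι] {lo hi h R : ℝ}
    (hh : 0 ≤ h) (hlo : lo + h ≤ hi) (δ : ι → ℝ) (U D : Finset ι) (hU : ∀ i ∈ U, δ i ≤ h)
    (hD : ∀ i ∈ D, -h ≤ δ i) (hUs : R ≤ ∑ i ∈ U, δ i) (hDs : ∑ i ∈ D, δ i ≤ -R) (g : ℝ)
    (h1 : lo ≤ g + R) (h2 : g - R ≤ hi) :
    ∃ Q : Finset ι, (Q ⊆ U ∨ Q ⊆ D) ∧ lo ≤ g + ∑ i ∈ Q, δ i ∧ g + ∑ i ∈ Q, δ i ≤ hi := by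
  rcases le_total g hi with hg | hg
  · obtain ⟨Q, hQ, h3⟩ := exists_subset_sum_mem_Icc hlo δ U hU g hg (by linarith)
    exact ⟨Q, .inl hQ, h3⟩
  · have hlo' : -hi + h ≤ -lo := by linarith
    obtain ⟨Q, hQ, h3, h4⟩ := exists_subset_sum_mem_Icc hlo' (fun i => -δ i) D
      (fun i hi => by linarith [hD i hi]) (-g) (by linarith) (by
        rw [Finset.sum_neg_distrib]; linarith)
    rw [Finset.sum_neg_distrib] at h3 h4
    exact ⟨Q, .inr hQ, by linarith, by linarith⟩

/-- The flipping process: `flipped i` records whether coordinate `i` is at its second ideal value,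
`thaw i` is the time from which it may be flipped again, and `count` is the number of flips. -/
structure FlipState (n : ℕ) where
  flipped : Fin n → Bool
  thaw : Fin n → ℕ
  count : ℕ

namespace FlipState

variable {n : ℕ}

/-- Flipping the coordinate `i` increases the sum of the ideal values. -/
def IsUp (σ : FlipState n) (i : Fin n) : Prop := Even (i : ℕ) ↔ σ.flipped i = false

/-- Coordinate `i` is flipped when it is selected at time `t`. Flips alternately increase and
decrease the sum of the ideal values. -/
def Flips (σ : FlipState n) (t : ℕ) (i : Fin n) : Prop :=
  σ.thaw i ≤ t ∧ (Even σ.count ↔ σ.IsUp i)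

-- Freezing makes each flip among the last `a` updates the latest flip of its coordinate, so one
-- stored old value per coordinate suffices.
open Classical in
noncomputable def next (a : ℕ) (σ : FlipState n) (t : ℕ) (i : Fin n) : FlipState n :=
  if σ.Flips t i then
    ⟨Function.update σ.flipped i (!σ.flipped i), Function.update σ.thaw i (t + a + 1), σ.count + 1⟩
  else σ

noncomputable def run (a : ℕ) (κ : ℕ → Fin n) : ℕ → FlipState n
  | 0 => ⟨fun _ => false, fun _ => 0, 0⟩
  | t + 1 => (run a κ t).next a t (κ t)

def FlipsAt (a : ℕ) (κ : ℕ → Fin n) (t : ℕ) : Prop := (run a κ t).Flips t (κ t)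

variable {a : ℕ} {κ : ℕ → Fin n}

theorem run_congr {κ' : ℕ → Fin n} {t : ℕ} (h : ∀ s < t, κ s = κ' s) :
    run a κ t = run a κ' t := by
  induction t with
  | zero => rfl
  | succ t ih =>
    rw [run, run, ih fun s hs => h s (by omega), h t (by omega)]

theorem flipsAt_congr {κ' : ℕ → Fin n} {t : ℕ} (h : ∀ s ≤ t, κ s = κ' s) :
    FlipsAt a κ t ↔ FlipsAt a κ' t := by
  rw [FlipsAt, FlipsAt, run_congr fun s hs => h s hs.le, h t le_rfl]

theorem run_succ_of_flipsAt {t : ℕ} (h : FlipsAt a κ t) : run a κ (t + 1) =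
    ⟨Function.update (run a κ t).flipped (κ t) (!(run a κ t).flipped (κ t)),
      Function.update (run a κ t).thaw (κ t) (t + a + 1), (run a κ t).count + 1⟩ :=
  if_pos h

theorem run_succ_of_not_flipsAt {t : ℕ} (h : ¬FlipsAt a κ t) : run a κ (t + 1) = run a κ t :=
  if_neg h

theorem count_succ (t : ℕ) [Decidable (FlipsAt a κ t)] :
    (run a κ (t + 1)).count = (run a κ t).count + if FlipsAt a κ t then 1 else 0 := by
  split_ifs with h
  · rw [run_succ_of_flipsAt h]
  · rw [run_succ_of_not_flipsAt h, add_zero]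

theorem frozen {s : ℕ} (hs : FlipsAt a κ s) {t : ℕ} (h1 : s < t) (h2 : t ≤ s + a + 1) :
    (run a κ t).thaw (κ s) = s + a + 1 ∧
      (run a κ t).flipped (κ s) = !(run a κ s).flipped (κ s) := by
  induction t, h1 using Nat.le_induction with
  | base => simp [run_succ_of_flipsAt hs]
  | succ t ht ih =>
    have ht' : s < t := ht
    have ih := ih (by omega)
    by_cases hf : FlipsAt a κ t
    · have hne : κ s ≠ κ t := by
        intro he
        have := hf.1
        rw [← he, ih.1] at this
        omega
      rw [run_succ_of_flipsAt hf]
      simpa [Function.update_of_ne hne] using ih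
    · rwa [run_succ_of_not_flipsAt hf]

theorem ne_of_flipsAt {s t : ℕ} (hs : FlipsAt a κ s) (ht : FlipsAt a κ t) (h1 : s < t)
    (h2 : t ≤ s + a) : κ s ≠ κ t := by
  intro he
  have := ht.1
  rw [← he, (frozen hs h1 (by omega)).1] at this
  omega

theorem exists_flipsAt_of_thaw {t : ℕ} {i : Fin n} (h : (run a κ t).thaw i ≠ 0) :
    ∃ s < t, FlipsAt a κ s ∧ κ s = i ∧ (run a κ t).thaw i = s + a + 1 := by
  induction t with
  | zero => simp [run] at h
  | succ t ih =>
    by_cases hf : FlipsAt a κ t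
    · rw [run_succ_of_flipsAt hf] at h ⊢
      by_cases hi : i = κ t
      · subst hi
        exact ⟨t, by omega, hf, rfl, by simp⟩
      · simp only [Function.update_of_ne hi] at h ⊢
        obtain ⟨s, hs, h⟩ := ih h
        exact ⟨s, by omega, h⟩
    · rw [run_succ_of_not_flipsAt hf] at h ⊢
      obtain ⟨s, hs, h⟩ := ih h
      exact ⟨s, by omega, h⟩

/-- The coordinates that have been flipped in the last `a` steps. -/
def recent (σ : FlipState n) (t : ℕ) : Finset (Fin n) := Finset.univ.filter fun i => t < σ.thaw i

theorem mem_recent {σ : FlipState n} {t : ℕ} {i : Fin n} : i ∈ σ.recent t ↔ t < σ.thaw i := by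
  simp [recent]

theorem exists_flipsAt_of_mem_recent {t : ℕ} {i : Fin n} (h : i ∈ (run a κ t).recent t) :
    ∃ s < t, t ≤ s + a ∧ FlipsAt a κ s ∧ κ s = i ∧ (run a κ t).thaw i = s + a + 1 := by
  rw [mem_recent] at h
  obtain ⟨s, hs, h1, h2, h3⟩ := exists_flipsAt_of_thaw (by omega : (run a κ t).thaw i ≠ 0)
  exact ⟨s, hs, by omega, h1, h2, h3⟩

theorem card_recent_le (t : ℕ) : ((run a κ t).recent t).card ≤ a := by
  have : (run a κ t).recent t ⊆ (Finset.Ico (t - a) t).image κ := by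
    intro i hi
    obtain ⟨s, hs, h1, _, h2, _⟩ := exists_flipsAt_of_mem_recent hi
    exact Finset.mem_image.2 ⟨s, Finset.mem_Ico.2 ⟨by omega, hs⟩, h2⟩
  refine (Finset.card_le_card this).trans (Finset.card_image_le.trans ?_)
  rw [Nat.card_Ico]
  omega

/-- Up to time `a` nothing has thawed, so a coordinate has flipped at most once and only away from
its initial value. -/
theorem thaw_ne_zero_iff {t : ℕ} (ht : t ≤ a) (i : Fin n) :
    (run a κ t).thaw i ≠ 0 ↔ (run a κ t).flipped i = true := by
  induction t with
  | zero => simp [run]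
  | succ t ih =>
    have ih := ih (by omega)
    by_cases hf : FlipsAt a κ t
    · rw [run_succ_of_flipsAt hf]
      by_cases hi : i = κ t
      · subst hi
        have h0 : (run a κ t).thaw (κ t) = 0 := by
          by_contra h0
          obtain ⟨s, _, _, _, h3⟩ := exists_flipsAt_of_thaw h0
          have := hf.1
          omega
        simpa [h0] using ih
      · simpa [Function.update_of_ne hi] using ih
    · rwa [run_succ_of_not_flipsAt hf]

theorem flipped_eq_false_of_flipsAt {t : ℕ} (ht : t < a) (hf : FlipsAt a κ t) :
    (run a κ t).flipped (κ t) = false := by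
  rw [← Bool.not_eq_true, ← thaw_ne_zero_iff ht.le, not_not]
  by_contra h0
  obtain ⟨s, _, _, _, h3⟩ := exists_flipsAt_of_thaw h0
  have := hf.1
  omega

theorem card_flipped_le (t : ℕ) : (Finset.univ.filter fun i => (run a κ t).flipped i).card ≤ t := by
  induction t with
  | zero => simp [run]
  | succ t ih =>
    by_cases hf : FlipsAt a κ t
    · rw [run_succ_of_flipsAt hf]
      refine (Finset.card_le_card (t := insert (κ t)
        (Finset.univ.filter fun i => (run a κ t).flipped i)) ?_).trans
        ((Finset.card_insert_le _ _).trans (by omega))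
      intro i hi
      by_cases h : i = κ t
      · simp [h]
      · simpa [Function.update_of_ne h, h] using hi
    · rw [run_succ_of_not_flipsAt hf]
      omega

-- Flips made at an even count are upward, those at an odd count downward; among the first `N` flips
-- there are `(N + 1) / 2` and `N / 2` of them, rounded down.
open Classical in
theorem card_filter_flipsAt {w t : ℕ} (hwt : w ≤ t) :
    ((Finset.Ico w t).filter fun s => FlipsAt a κ s ∧ Even (run a κ s).count).card +
        ((run a κ w).count + 1) / 2 = ((run a κ t).count + 1) / 2 ∧
      ((Finset.Ico w t).filter fun s => FlipsAt a κ s ∧ ¬Even (run a κ s).count).card +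
        (run a κ w).count / 2 = (run a κ t).count / 2 := by
  induction t, hwt using Nat.le_induction with
  | base => simp
  | succ t ht ih =>
    have hI : Finset.Ico w (t + 1) = insert t (Finset.Ico w t) := by
      ext; simp only [Finset.mem_Ico, Finset.mem_insert]; omega
    rw [hI, Finset.filter_insert, Finset.filter_insert, count_succ]
    by_cases hf : FlipsAt a κ t
    · by_cases he : Even (run a κ t).count
      · simp only [hf, he, not_true, and_self, and_false, if_true, if_false]
        rw [Finset.card_insert_of_notMem (by simp)]
        obtain ⟨m, hm⟩ := he
        omega
      · simp only [hf, he, not_false_eq_true, and_self, and_false, if_true, if_false]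
        rw [Finset.card_insert_of_notMem (by simp)]
        obtain ⟨m, hm⟩ := Nat.not_even_iff_odd.1 he
        omega
    · simpa [hf] using ih

open Classical in
/-- Among the coordinates flipped in the last `a` steps, about half were flipped upwards, and about
half downwards. -/
theorem card_recent_filter_ge {t : ℕ} (ht : a ≤ t) :
    (run a κ t).count ≤ (run a κ (t - a)).count +
        2 * (((run a κ t).recent t).filter fun i => ¬(run a κ t).IsUp i).card + 1 ∧
      (run a κ t).count ≤ (run a κ (t - a)).count +
        2 * (((run a κ t).recent t).filter fun i => (run a κ t).IsUp i).card + 1 := by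
  -- A coordinate flipped upwards is still frozen at `t`, so its next flip would go down: its
  -- current `IsUp` status is the reverse of the direction of its last flip.
  have key : ∀ s ∈ Finset.Ico (t - a) t, FlipsAt a κ s → κ s ∈ (run a κ t).recent t ∧
      ((run a κ t).IsUp (κ s) ↔ ¬Even (run a κ s).count) := by
    intro s hs hf
    rw [Finset.mem_Ico] at hs
    obtain ⟨h1, h2⟩ := frozen hf hs.2 (by omega)
    refine ⟨mem_recent.2 (by omega), ?_⟩
    rw [hf.2, IsUp, IsUp, h2]
    cases (run a κ s).flipped (κ s) <;> simp
  have inj : ∀ s ∈ Finset.Ico (t - a) t, ∀ s' ∈ Finset.Ico (t - a) t, FlipsAt a κ s →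
      FlipsAt a κ s' → κ s = κ s' → s = s' := by
    intro s hs s' hs' hf hf' he
    rw [Finset.mem_Ico] at hs hs'
    rcases lt_trichotomy s s' with h | h | h
    · exact absurd he (ne_of_flipsAt hf hf' h (by omega))
    · exact h
    · exact absurd he.symm (ne_of_flipsAt hf' hf h (by omega))
  obtain ⟨h1, h2⟩ := card_filter_flipsAt (a := a) (κ := κ) (Nat.sub_le t a)
  have c1 : ((Finset.Ico (t - a) t).filter fun s => FlipsAt a κ s ∧ Even (run a κ s).count).card ≤
      (((run a κ t).recent t).filter fun i => ¬(run a κ t).IsUp i).card := by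
    refine Finset.card_le_card_of_injOn κ ?_ ?_
    · intro s hs
      simp only [Finset.coe_filter, Set.mem_ofPred_eq] at hs ⊢
      obtain ⟨h3, h4⟩ := key s hs.1 hs.2.1
      exact ⟨h3, by rw [h4, not_not]; exact hs.2.2⟩
    · intro s hs s' hs' he
      simp only [Finset.coe_filter, Set.mem_ofPred_eq] at hs hs'
      exact inj s hs.1 s' hs'.1 hs.2.1 hs'.2.1 he
  have c2 : ((Finset.Ico (t - a) t).filter fun s => FlipsAt a κ s ∧ ¬Even (run a κ s).count).card ≤
      (((run a κ t).recent t).filter fun i => (run a κ t).IsUp i).card := by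
    refine Finset.card_le_card_of_injOn κ ?_ ?_
    · intro s hs
      simp only [Finset.coe_filter, Set.mem_ofPred_eq] at hs ⊢
      obtain ⟨h3, h4⟩ := key s hs.1 hs.2.1
      exact ⟨h3, h4.2 hs.2.2⟩
    · intro s hs s' hs' he
      simp only [Finset.coe_filter, Set.mem_ofPred_eq] at hs hs'
      exact inj s hs.1 s' hs'.1 hs.2.1 hs'.2.1 he
  omega

/-- The imbalance between the flipped coordinates with positive and negative initial values. -/
theorem sum_startPoint_mul_flipped (t : ℕ) :
    ∑ i, startPoint n i * (if (run a κ t).flipped i then 1 else 0) =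
      if Even (run a κ t).count then 0 else (-1 : ℝ) := by
  induction t with
  | zero => simp [run]
  | succ t ih =>
    by_cases hf : FlipsAt a κ t
    · rw [run_succ_of_flipsAt hf]
      have hsum : ∑ i, startPoint n i * (if Function.update (run a κ t).flipped (κ t)
            (!(run a κ t).flipped (κ t)) i then (1 : ℝ) else 0) =
          ∑ i, startPoint n i * (if (run a κ t).flipped i then 1 else 0) +
            startPoint n (κ t) * ((if !(run a κ t).flipped (κ t) then 1 else 0) -
              if (run a κ t).flipped (κ t) then 1 else 0) := by
        rw [← sub_eq_iff_eq_add', ← Finset.sum_sub_distrib, Finset.sum_eq_single (κ t)]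
        · simp [mul_sub]
        · intro i _ hi
          simp [Function.update_of_ne hi]
        · simp
      simp only [hsum, ih]
      have h2 := hf.2
      rw [IsUp] at h2
      unfold startPoint
      generalize (run a κ t).flipped (κ t) = b at *
      by_cases he : Even (run a κ t).count <;> cases b <;> by_cases hk : Even (κ t : ℕ) <;>
        simp_all [Nat.even_add_one, -Nat.not_even_iff_odd]
    · rw [run_succ_of_not_flipsAt hf, ih]

end FlipState

/-- The two ideal values of coordinate `i`. -/
noncomputable def ideal {n : ℕ} (α : ℝ) (i : Fin n) (b : Bool) : ℝ := startPoint n i * if b then 1 - α else 1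

/-- The purpose of alternation: the sum of the ideal values never drifts, so the reads only have to
compensate for `α` and the deviations. -/
theorem sum_ideal_run {n : ℕ} (hn : Even n) (α : ℝ) (a : ℕ) (κ : ℕ → Fin n) (t : ℕ) :
    ∑ i, ideal α i ((FlipState.run a κ t).flipped i) =
      if Even (FlipState.run a κ t).count then 0 else α := by
  have : ∀ i, ideal α i ((FlipState.run a κ t).flipped i) = startPoint n i -
      α * (startPoint n i * if (FlipState.run a κ t).flipped i then 1 else 0) := by
    intro i
    unfold ideal
    split_ifs <;> ring
  simp only [this, Finset.sum_sub_distrib, ← Finset.mul_sum, sum_startPoint hn,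
    FlipState.sum_startPoint_mul_flipped]
  split_ifs <;> ring

theorem ideal_sub_ideal_not {n : ℕ} (α : ℝ) (σ : FlipState n) (i : Fin n) [Decidable (σ.IsUp i)] :
    ideal α i (σ.flipped i) - ideal α i (!σ.flipped i) = if σ.IsUp i then -α else α := by
  unfold ideal startPoint
  by_cases h : σ.IsUp i
  · rw [if_pos h]
    rw [FlipState.IsUp] at h
    cases hb : σ.flipped i
    · simp_all
      ring
    · simp_all [-Nat.not_even_iff_odd]
  · rw [if_neg h]
    rw [FlipState.IsUp] at h
    cases hb : σ.flipped i <;> simp_all [-Nat.not_even_iff_odd]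

end SACD
-- Steering an update by a choice of old values, and the resulting memory process.
namespace SACD

open FlipState

/-- The relative size of the correction made by an update. -/
noncomputable def alpha (ε γ : ℝ) : ℝ := (1 - ε) / γ

/-- The largest deviation from an ideal value. -/
noncomputable def nu (ε γ : ℝ) : ℝ := 3 * ε * alpha ε γ / (γ - 6 * ε)

/-- The ranges of the parameters for which an update can be steered, when at least `F` of
the last updates were flips and the deviations from the ideal values add up to at most `B * nu`. -/
structure Regime (ε γ F B : ℝ) : Prop where
  pos : 0 < ε
  le : ε ≤ 1 / 18
  one_le : 1 ≤ γ
  range : alpha ε γ * (2 - alpha ε γ) + 2 * nu ε γ + ε / γ * (alpha ε γ + B * nu ε γ) ≤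
    (F - 3) / 2 * (ε / γ * (alpha ε γ - 2 * nu ε γ))

namespace Regime

variable {ε γ F B : ℝ} (h : Regime ε γ F B)
include h

theorem gamma_pos : 0 < γ := by linarith [h.one_le]

theorem alpha_pos : 0 < alpha ε γ := div_pos (by linarith [h.le]) h.gamma_pos

theorem alpha_le_one : alpha ε γ ≤ 1 := by
  rw [alpha, div_le_one h.gamma_pos]
  linarith [h.pos, h.one_le]

theorem denom_pos : 0 < γ - 6 * ε := by linarith [h.le, h.one_le]

theorem nu_pos : 0 < nu ε γ :=
  div_pos (mul_pos (mul_pos three_pos h.pos) h.alpha_pos) h.denom_pos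

theorem nu_le : nu ε γ ≤ alpha ε γ / 4 := by
  rw [nu, div_le_iff₀ h.denom_pos]
  nlinarith [h.alpha_pos, h.le, h.one_le]

/-- This identity dictates the value of `ν`: the length of the band `[2ν/3, ν]` equals the largest
shift that one old read can cause, namely `ε/γ` times a flip of size `α` with a deviation `ν` at
both ends. -/
theorem nu_div_three : nu ε γ / 3 = ε / γ * (alpha ε γ + 2 * nu ε γ) := by
  have h1 := h.gamma_pos.ne'
  have h2 : nu ε γ * (γ - 6 * ε) = 3 * ε * alpha ε γ := div_mul_cancel₀ _ h.denom_pos.ne'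
  field_simp
  linarith

end Regime

structure MemState (n : ℕ) where
  cur : Fin n → ℝ
  /-- The value of a coordinate before its last flip. -/
  old : Fin n → ℝ

/-- The value written to coordinate `j` by an update that reads the old values of the coordinates
in `Q` and the current values of the others. -/
noncomputable def newValue {n : ℕ} (ε γ : ℝ) (μ : MemState n) (Q : Finset (Fin n)) (j : Fin n) :
    ℝ :=
  μ.cur j - ((1 - ε) * μ.cur j + ε * ∑ i, if i ∈ Q then μ.old i else μ.cur i) / γ

/-- The deviation `e` has the size prescribed by `ν`, and sign opposite to `Y`. -/
def InBand (ν Y e : ℝ) : Prop :=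
  if 0 ≤ Y then -ν ≤ e ∧ e ≤ -(2 / 3 * ν) else 2 / 3 * ν ≤ e ∧ e ≤ ν

theorem InBand.abs {ν Y e : ℝ} (hν : 0 ≤ ν) (h : InBand ν Y e) : 2 / 3 * ν ≤ |e| ∧ |e| ≤ ν := by
  rw [InBand] at h
  split_ifs at h with hY
  · rw [abs_of_nonpos (by linarith)]
    constructor <;> linarith
  · rw [abs_of_nonneg (by linarith)]
    constructor <;> linarith

theorem newValue_eq {n : ℕ} (ε γ : ℝ) (μ : MemState n) (Q : Finset (Fin n)) (j : Fin n) :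
    newValue ε γ μ Q j = μ.cur j - alpha ε γ * μ.cur j - ε / γ * ∑ i, μ.cur i +
      ∑ i ∈ Q, ε / γ * (μ.cur i - μ.old i) := by
  have : ∑ i, (if i ∈ Q then μ.old i else μ.cur i) =
      ∑ i, μ.cur i - ∑ i ∈ Q, (μ.cur i - μ.old i) := by
    have h : ∑ i ∈ Q, (μ.cur i - μ.old i) = ∑ i, if i ∈ Q then μ.cur i - μ.old i else 0 := by
      rw [← Finset.sum_filter, Finset.filter_mem_eq_inter, Finset.univ_inter]
    rw [h, ← Finset.sum_sub_distrib]
    refine Finset.sum_congr rfl fun i _ => ?_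
    split_ifs <;> ring
  rw [newValue, this, ← Finset.mul_sum, alpha]
  ring

/-- The extreme case is the return from `1 - α` to `1`: a gain of `α` is wanted, while the step
itself takes off `α (1 - α)`. -/
theorem abs_ideal_step_le {n : ℕ} {α : ℝ} (h0 : 0 ≤ α) (h1 : α ≤ 1) (j : Fin n) (b b' : Bool) :
    |ideal α j b - ideal α j b' - α * ideal α j b| ≤ α * (2 - α) := by
  have hs : |startPoint n j| = 1 := by
    unfold startPoint
    split_ifs <;> norm_num
  have : ideal α j b - ideal α j b' - α * ideal α j b = startPoint n j *
      ((if b then 1 - α else 1) - (if b' then 1 - α else 1) - α * if b then 1 - α else 1) := by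
    unfold ideal
    ring
  rw [this, abs_mul, hs, one_mul]
  cases b <;> cases b' <;> simp only [Bool.false_eq_true, if_false, if_true, abs_le] <;>
    constructor <;> nlinarith

/-- An update can be steered into the prescribed range of deviations from a given ideal value. -/
theorem exists_inBand {n : ℕ} {ε γ F B : ℝ} (h : Regime ε γ F B) (σ : FlipState n)
    (R : Finset (Fin n)) (μ : MemState n) (j : Fin n) (b : Bool) (Y : ℝ)
    [DecidablePred σ.IsUp]
    (hY : Y = ∑ i, (μ.cur i - ideal (alpha ε γ) i (σ.flipped i)))
    (hYB : |Y| ≤ B * nu ε γ)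
    (hcur : ∀ i, |μ.cur i - ideal (alpha ε γ) i (σ.flipped i)| ≤ nu ε γ)
    (hold : ∀ i ∈ R, |μ.old i - ideal (alpha ε γ) i (!σ.flipped i)| ≤ nu ε γ)
    (hsum : |∑ i, ideal (alpha ε γ) i (σ.flipped i)| ≤ alpha ε γ)
    (hU : F ≤ 2 * (R.filter fun i => ¬σ.IsUp i).card + 1)
    (hD : F ≤ 2 * (R.filter fun i => σ.IsUp i).card + 1) :
    ∃ Q ⊆ R, j ∉ Q ∧ InBand (nu ε γ) Y (newValue ε γ μ Q j - ideal (alpha ε γ) j b) := by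
  have hα := h.alpha_pos
  have hα1 := h.alpha_le_one
  have hν := h.nu_pos
  have hν4 := h.nu_le
  have hν3 := h.nu_div_three
  have hrange := h.range
  have hu : 0 < ε / γ := div_pos h.pos h.gamma_pos
  set α := alpha ε γ
  set ν := nu ε γ
  set u := ε / γ
  set V : Fin n → ℝ := fun i => ideal α i (σ.flipped i)
  have hδ : ∀ i ∈ R, (σ.IsUp i → -(ν / 3) ≤ u * (μ.cur i - μ.old i) ∧
      u * (μ.cur i - μ.old i) ≤ -(u * (α - 2 * ν))) ∧
      (¬σ.IsUp i → u * (μ.cur i - μ.old i) ≤ ν / 3 ∧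
        u * (α - 2 * ν) ≤ u * (μ.cur i - μ.old i)) := by
    intro i hi
    have h1 := abs_le.1 (hcur i)
    have h2 := abs_le.1 (hold i hi)
    have h3 := ideal_sub_ideal_not α σ i
    rw [hν3]
    constructor
    · intro hup
      rw [if_pos hup] at h3
      rw [← mul_neg, ← mul_neg]
      constructor <;> refine mul_le_mul_of_nonneg_left ?_ hu.le <;> linarith
    · intro hup
      rw [if_neg hup] at h3
      constructor <;> refine mul_le_mul_of_nonneg_left ?_ hu.le <;> linarith
  -- The updated coordinate itself must be read at its current value; giving it up costs one element
  -- on each side and turns `(F - 1) / 2` into `(F - 3) / 2`.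
  set U := (R.filter fun i => ¬σ.IsUp i).erase j
  set D := (R.filter fun i => σ.IsUp i).erase j
  set K := (F - 3) / 2
  have hc0 : 0 ≤ u * (α - 2 * ν) := mul_nonneg hu.le (by linarith)
  have hUK : K ≤ U.card := by
    have := Finset.pred_card_le_card_erase (s := R.filter fun i => ¬σ.IsUp i) (a := j)
    have h2 : ((R.filter fun i => ¬σ.IsUp i).card : ℝ) ≤ U.card + 1 := by
      exact_mod_cast Nat.le_add_of_sub_le this
    simp only [K]
    linarith
  have hDK : K ≤ D.card := by
    have := Finset.pred_card_le_card_erase (s := R.filter fun i => σ.IsUp i) (a := j)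
    have h2 : ((R.filter fun i => σ.IsUp i).card : ℝ) ≤ D.card + 1 := by
      exact_mod_cast Nat.le_add_of_sub_le this
    simp only [K]
    linarith
  have hUs : K * (u * (α - 2 * ν)) ≤ ∑ i ∈ U, u * (μ.cur i - μ.old i) := by
    refine (mul_le_mul_of_nonneg_right hUK hc0).trans ?_
    rw [← nsmul_eq_mul]
    refine Finset.card_nsmul_le_sum _ _ _ fun i hi => ?_
    have hi' := Finset.mem_filter.1 (Finset.mem_of_mem_erase hi)
    exact ((hδ i hi'.1).2 hi'.2).2
  have hDs : ∑ i ∈ D, u * (μ.cur i - μ.old i) ≤ -(K * (u * (α - 2 * ν))) := by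
    refine le_trans ?_ (neg_le_neg (mul_le_mul_of_nonneg_right hDK hc0))
    rw [← mul_neg, ← nsmul_eq_mul]
    refine Finset.sum_le_card_nsmul _ _ _ fun i hi => ?_
    have hi' := Finset.mem_filter.1 (Finset.mem_of_mem_erase hi)
    exact ((hδ i hi'.1).1 hi'.2).2
  set g := μ.cur j - α * μ.cur j - u * ∑ i, μ.cur i - ideal α j b with hg
  -- `g` is the deviation obtained when only current values are read. The three terms come from the
  -- ideal step, the deviation of coordinate `j`, and the sum of all coordinates. The second `ν` in
  -- `Regime.range` pays for the position of the target window.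
  have hgabs : |g| ≤ α * (2 - α) + ν + u * (α + B * ν) := by
    have e1 : g = (V j - ideal α j b - α * V j) + ((1 - α) * (μ.cur j - V j) +
        -(u * (∑ i, V i + Y))) := by
      rw [hY, Finset.sum_sub_distrib, hg]
      simp only [V]
      ring
    rw [e1]
    have e2 : |(1 - α) * (μ.cur j - V j)| ≤ ν := by
      rw [abs_mul, abs_of_nonneg (by linarith)]
      nlinarith [hcur j, abs_nonneg (μ.cur j - V j)]
    have e3 : |-(u * (∑ i, V i + Y))| ≤ u * (α + B * ν) := by
      rw [abs_neg, abs_mul, abs_of_pos hu]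
      exact mul_le_mul_of_nonneg_left ((abs_add_le _ _).trans (add_le_add hsum hYB)) hu.le
    have e4 := abs_ideal_step_le hα.le hα1 j (σ.flipped j) b
    refine (abs_add_le _ _).trans ?_
    have e5 := abs_add_le ((1 - α) * (μ.cur j - V j)) (-(u * (∑ i, V i + Y)))
    simp only [V] at *
    linarith
  have hg1 := abs_le.1 hgabs
  -- Both bands of `InBand` are windows of length exactly `ν / 3` inside `[-ν, ν]`, so one statement
  -- serves for either sign of `Y`.
  have main : ∀ lo hi : ℝ, lo + ν / 3 ≤ hi → lo ≤ ν → -ν ≤ hi → ∃ Q ⊆ R, j ∉ Q ∧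
      lo ≤ newValue ε γ μ Q j - ideal α j b ∧ newValue ε γ μ Q j - ideal α j b ≤ hi := by
    intro lo hi hlh hlo hhi
    obtain ⟨Q, hQ, h1, h2⟩ := exists_subset_sum_mem_Icc_of_abs (h := ν / 3) (lo := lo) (hi := hi)
      (by linarith) hlh (fun i => u * (μ.cur i - μ.old i)) U D
      (fun i hi => by
        have hi' := Finset.mem_filter.1 (Finset.mem_of_mem_erase hi)
        exact ((hδ i hi'.1).2 hi'.2).1)
      (fun i hi => by
        have hi' := Finset.mem_filter.1 (Finset.mem_of_mem_erase hi)
        exact ((hδ i hi'.1).1 hi'.2).1) hUs hDs g (by linarith) (by linarith)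
    have hval : newValue ε γ μ Q j - ideal α j b = g + ∑ i ∈ Q, u * (μ.cur i - μ.old i) := by
      rw [newValue_eq, hg]
      ring
    refine ⟨Q, ?_, ?_, by rw [hval]; exact h1, by rw [hval]; exact h2⟩
    · rcases hQ with hQ | hQ <;>
        exact hQ.trans ((Finset.erase_subset _ _).trans (Finset.filter_subset _ _))
    · rcases hQ with hQ | hQ <;> exact fun hj => Finset.notMem_erase j _ (hQ hj)
  simp only [InBand]
  split_ifs
  · exact main _ _ (by linarith) (by linarith) (by linarith)
  · exact main _ _ (by linarith) (by linarith) (by linarith)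

open Classical in
/-- A subset of `R` for which the value written to coordinate `j` deviates from `v` by a prescribed
amount, of sign opposite to `Y`. -/
noncomputable def steer {n : ℕ} (ε γ : ℝ) (μ : MemState n) (R : Finset (Fin n)) (j : Fin n)
    (v Y : ℝ) : Finset (Fin n) :=
  if h : ∃ Q ⊆ R, j ∉ Q ∧ InBand (nu ε γ) Y (newValue ε γ μ Q j - v) then h.choose else ∅

theorem inBand_steer {n : ℕ} {ε γ : ℝ} {μ : MemState n} {R : Finset (Fin n)} {j : Fin n}
    {v Y : ℝ} (h : ∃ Q ⊆ R, j ∉ Q ∧ InBand (nu ε γ) Y (newValue ε γ μ Q j - v)) :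
    InBand (nu ε γ) Y (newValue ε γ μ (steer ε γ μ R j v Y) j - v) := by
  rw [steer, dif_pos h]
  exact h.choose_spec.2.2

section MemRun

variable {n : ℕ} (a : ℕ) (ε γ : ℝ) (κ : ℕ → Fin n)

/-- The update `t` is made in the first phase, in which all updates read the initial vector. -/
def IsEarly (t : ℕ) : Prop := t < a ∧ FlipsAt a κ t

/-- All early flips commit before any other update does. Hence even updates with `t < a` aim at the
ideal values of time `a`, which is the reason for `max t a` throughout. -/
noncomputable def deviation (μ : MemState n) (t : ℕ) (i : Fin n) : ℝ :=
  μ.cur i - ideal (alpha ε γ) i ((run a κ (max t a)).flipped i)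

/-- The coordinates whose old values are read by update `t`. -/
noncomputable def oldReads (μ : MemState n) (t : ℕ) : Finset (Fin n) :=
  steer ε γ μ ((run a κ (max t a)).recent (max t a)) (κ t)
    (ideal (alpha ε γ) (κ t) ((run a κ (max (t + 1) a)).flipped (κ t)))
    (∑ i, deviation a ε γ κ μ t i)

open Classical in
/-- The content of the memory when all early updates and the updates before `t` have committed. -/
noncomputable def memRun : ℕ → MemState n
  | 0 => ⟨fun i => ideal (alpha ε γ) i ((run a κ a).flipped i), startPoint n⟩
  | t + 1 =>
    if IsEarly a κ t then memRun t else
      ⟨Function.update (memRun t).cur (κ t)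
          (newValue ε γ (memRun t) (oldReads a ε γ κ (memRun t) t) (κ t)),
        if FlipsAt a κ t then Function.update (memRun t).old (κ t) ((memRun t).cur (κ t))
        else (memRun t).old⟩

noncomputable def err (t : ℕ) (i : Fin n) : ℝ := deviation a ε γ κ (memRun a ε γ κ t) t i

noncomputable def errSum (t : ℕ) : ℝ := ∑ i, err a ε γ κ t i

/-- Update `t` can be steered. -/
def Steerable (F B : ℝ) (t : ℕ) : Prop :=
  (run a κ (max t a - a)).count + F ≤ (run a κ (max t a)).count ∧
    |errSum a ε γ κ t| ≤ B * nu ε γ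

theorem oldReads_subset (μ : MemState n) (t : ℕ) :
    oldReads a ε γ κ μ t ⊆ (run a κ (max t a)).recent (max t a) := by
  rw [oldReads, steer]
  split_ifs with h
  · exact h.choose_spec.1
  · exact Finset.empty_subset _

theorem notMem_oldReads (μ : MemState n) (t : ℕ) : κ t ∉ oldReads a ε γ κ μ t := by
  rw [oldReads, steer]
  split_ifs with h
  · exact h.choose_spec.2.1
  · exact Finset.notMem_empty _

variable {a ε γ κ}

/-- This and the following congruence lemmas serve twice: they show that the schedule does not look
into the future, and they allow averaging over one selected coordinate with the past held fixed. -/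
theorem isEarly_congr {κ' : ℕ → Fin n} {t : ℕ} (h : ∀ s ≤ t, κ s = κ' s) :
    IsEarly a κ t ↔ IsEarly a κ' t := by
  rw [IsEarly, IsEarly, flipsAt_congr h]

theorem oldReads_congr {κ' : ℕ → Fin n} (μ : MemState n) {t : ℕ}
    (h : ∀ s < max (t + 1) a, κ s = κ' s) : oldReads a ε γ κ μ t = oldReads a ε γ κ' μ t := by
  have h1 : run a κ (max t a) = run a κ' (max t a) :=
    run_congr fun s hs => h s (by omega)
  have h2 : run a κ (max (t + 1) a) = run a κ' (max (t + 1) a) := run_congr h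
  have h3 : κ t = κ' t := h t (by omega)
  simp only [oldReads, deviation]
  rw [h1, h2, h3]

theorem memRun_congr {κ' : ℕ → Fin n} {t : ℕ} (h : ∀ s < max t a, κ s = κ' s) :
    memRun a ε γ κ t = memRun a ε γ κ' t := by
  induction t with
  | zero => simp only [memRun, run_congr (κ := κ) (κ' := κ') (t := a) fun s hs => h s (by omega)]
  | succ t ih =>
    have ih := ih fun s hs => h s (by omega)
    rw [memRun, memRun, ih, h t (by omega), oldReads_congr _ h,
      propext (isEarly_congr (a := a) (κ := κ) (κ' := κ') (t := t) fun s hs => h s (by omega)),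
      propext (flipsAt_congr (a := a) (κ := κ) (κ' := κ') (t := t) fun s hs => h s (by omega))]

theorem err_congr {κ' : ℕ → Fin n} {t : ℕ} (h : ∀ s < max t a, κ s = κ' s) :
    err a ε γ κ t = err a ε γ κ' t := by
  funext i
  rw [err, err, memRun_congr h, deviation, deviation, run_congr h]

theorem errSum_congr {κ' : ℕ → Fin n} {t : ℕ} (h : ∀ s < max t a, κ s = κ' s) :
    errSum a ε γ κ t = errSum a ε γ κ' t := by
  rw [errSum, errSum, err_congr h]

theorem steerable_congr {κ' : ℕ → Fin n} {F B : ℝ} {t : ℕ} (h : ∀ s < max t a, κ s = κ' s) :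
    Steerable a ε γ κ F B t ↔ Steerable a ε γ κ' F B t := by
  rw [Steerable, Steerable, errSum_congr h, run_congr h,
    run_congr (κ := κ) (κ' := κ') (t := max t a - a) fun s hs => h s (by omega)]

theorem memRun_succ_of_isEarly {t : ℕ} (h : IsEarly a κ t) :
    memRun a ε γ κ (t + 1) = memRun a ε γ κ t := by
  rw [memRun, if_pos h]

theorem memRun_succ_cur {t : ℕ} (h : ¬IsEarly a κ t) :
    (memRun a ε γ κ (t + 1)).cur = Function.update (memRun a ε γ κ t).cur (κ t)
      (newValue ε γ (memRun a ε γ κ t) (oldReads a ε γ κ (memRun a ε γ κ t) t) (κ t)) := by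
  rw [memRun, if_neg h]

theorem memRun_succ_old_of_flipsAt {t : ℕ} (ht : a ≤ t) (h : FlipsAt a κ t) :
    (memRun a ε γ κ (t + 1)).old =
      Function.update (memRun a ε γ κ t).old (κ t) ((memRun a ε γ κ t).cur (κ t)) := by
  rw [memRun, if_neg fun h' => by have := h'.1; omega, if_pos h]

theorem memRun_succ_old_of_not {t : ℕ} (h : ¬(a ≤ t ∧ FlipsAt a κ t)) :
    (memRun a ε γ κ (t + 1)).old = (memRun a ε γ κ t).old := by
  by_cases hf : FlipsAt a κ t
  · rw [memRun_succ_of_isEarly ⟨by by_contra h'; exact h ⟨by omega, hf⟩, hf⟩]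
  · rw [memRun, if_neg fun h' => hf h'.2, if_neg hf]

theorem flipped_max_succ_of_ne {t : ℕ} {i : Fin n} (hi : i ≠ κ t) :
    (run a κ (max (t + 1) a)).flipped i = (run a κ (max t a)).flipped i := by
  rcases Nat.lt_or_ge t a with h | h
  · rw [max_eq_right h, max_eq_right h.le]
  · rw [max_eq_left h, max_eq_left (by omega)]
    by_cases hf : FlipsAt a κ t
    · rw [run_succ_of_flipsAt hf]
      simp [hi]
    · rw [run_succ_of_not_flipsAt hf]

theorem err_succ_of_isEarly {t : ℕ} (h : IsEarly a κ t) : err a ε γ κ (t + 1) = err a ε γ κ t := by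
  funext i
  have := h.1
  rw [err, err, memRun_succ_of_isEarly h, deviation, deviation, max_eq_right this.le,
    max_eq_right (by omega : t + 1 ≤ a)]

theorem err_succ_of_ne {t : ℕ} {i : Fin n} (hi : i ≠ κ t) :
    err a ε γ κ (t + 1) i = err a ε γ κ t i := by
  by_cases h : IsEarly a κ t
  · rw [err_succ_of_isEarly h]
  · rw [err, err, deviation, deviation, memRun_succ_cur h, flipped_max_succ_of_ne hi,
      Function.update_of_ne hi]

/-- All deviations have one of the prescribed sizes, and old values are as expected. -/
structure Stalls (a : ℕ) (ε γ : ℝ) (κ : ℕ → Fin n) (t : ℕ) : Prop where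
  err : ∀ i, err a ε γ κ t i = 0 ∨
    (2 / 3 * nu ε γ ≤ |SACD.err a ε γ κ t i| ∧ |SACD.err a ε γ κ t i| ≤ nu ε γ)
  old : ∀ i ∈ (run a κ (max t a)).recent (max t a), |(memRun a ε γ κ t).old i -
    ideal (alpha ε γ) i (!(run a κ (max t a)).flipped i)| ≤ nu ε γ

theorem Stalls.abs_err_le {F B : ℝ} (h : Regime ε γ F B) {t : ℕ} (hs : Stalls a ε γ κ t)
    (i : Fin n) : |SACD.err a ε γ κ t i| ≤ nu ε γ := by
  rcases hs.err i with h0 | h0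
  · rw [h0, abs_zero]
    exact h.nu_pos.le
  · exact h0.2

theorem stalls_zero {F B : ℝ} (h : Regime ε γ F B) : Stalls a ε γ κ 0 where
  err i := .inl (by simp [SACD.err, deviation, memRun])
  old i hi := by
    have h0 : max 0 a = a := by omega
    rw [h0] at hi ⊢
    have := (thaw_ne_zero_iff (a := a) (κ := κ) (t := a) le_rfl i).1
      (by have := mem_recent.1 hi; omega)
    simp only [memRun, this, ideal]
    simpa using h.nu_pos.le

/-- Since flips alternate, `F` flips in the window leave about `F / 2` usable old values in each
direction, as `exists_inBand` requires. -/
theorem Stalls.inBand (hn : Even n) {F B : ℝ} (h : Regime ε γ F B) {t : ℕ}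
    (hs : Stalls a ε γ κ t) (hst : Steerable a ε γ κ F B t) (he : ¬IsEarly a κ t) :
    InBand (nu ε γ) (errSum a ε γ κ t) (SACD.err a ε γ κ (t + 1) (κ t)) := by
  classical
  have hc := card_recent_filter_ge (a := a) (κ := κ) (t := max t a) (by omega)
  have hex := exists_inBand h (run a κ (max t a)) ((run a κ (max t a)).recent (max t a))
    (memRun a ε γ κ t) (κ t) ((run a κ (max (t + 1) a)).flipped (κ t)) _ rfl hst.2
    (hs.abs_err_le h) hs.old (by
      rw [sum_ideal_run hn]
      split_ifs
      · simpa using h.alpha_pos.le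
      · rw [abs_of_pos h.alpha_pos])
    (by
      have h1 := hst.1
      have h2 : ((run a κ (max t a)).count : ℝ) ≤ (run a κ (max t a - a)).count +
        2 * (((run a κ (max t a)).recent (max t a)).filter fun i =>
          ¬(run a κ (max t a)).IsUp i).card + 1 := by exact_mod_cast hc.1
      linarith)
    (by
      have h1 := hst.1
      have h2 : ((run a κ (max t a)).count : ℝ) ≤ (run a κ (max t a - a)).count +
        2 * (((run a κ (max t a)).recent (max t a)).filter fun i =>
          (run a κ (max t a)).IsUp i).card + 1 := by exact_mod_cast hc.2
      linarith)
  rw [SACD.err, deviation, memRun_succ_cur he, Function.update_self]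
  exact inBand_steer hex

theorem Stalls.succ (hn : Even n) {F B : ℝ} (h : Regime ε γ F B) {t : ℕ}
    (hs : Stalls a ε γ κ t) (hst : Steerable a ε γ κ F B t) : Stalls a ε γ κ (t + 1) where
  err i := by
    by_cases he : IsEarly a κ t
    · rw [err_succ_of_isEarly he]
      exact hs.err i
    · by_cases hi : i = κ t
      · subst hi
        exact .inr ((hs.inBand hn h hst he).abs h.nu_pos.le)
      · rw [err_succ_of_ne hi]
        exact hs.err i
  old i hi := by
    rcases Nat.lt_or_ge t a with hta | hta
    · have h1 : max (t + 1) a = max t a := by omega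
      rw [h1] at hi ⊢
      rw [memRun_succ_old_of_not (by omega)]
      exact hs.old i hi
    · by_cases hf : FlipsAt a κ t
      · rw [memRun_succ_old_of_flipsAt hta hf]
        by_cases hik : i = κ t
        · subst hik
          rw [Function.update_self, max_eq_left (by omega : a ≤ t + 1), run_succ_of_flipsAt hf]
          have := hs.abs_err_le h (κ t)
          rw [SACD.err, deviation, max_eq_left hta] at this
          simpa using this
        · rw [Function.update_of_ne hik, flipped_max_succ_of_ne hik]
          refine hs.old i ?_
          rw [max_eq_left (by omega : a ≤ t + 1), mem_recent, run_succ_of_flipsAt hf] at hi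
          simp only [Function.update_of_ne hik] at hi
          rw [max_eq_left hta, mem_recent]
          omega
      · rw [memRun_succ_old_of_not (by tauto)]
        rw [max_eq_left (by omega : a ≤ t + 1), run_succ_of_not_flipsAt hf] at hi ⊢
        rw [mem_recent] at hi
        have := hs.old i
        rw [max_eq_left hta, mem_recent] at this
        exact this (by omega)

theorem stalls_of_steerable (hn : Even n) {F B : ℝ} (h : Regime ε γ F B) {t : ℕ}
    (hst : ∀ s < t, Steerable a ε γ κ F B s) : Stalls a ε γ κ t := by
  induction t with
  | zero => exact stalls_zero h
  | succ t ih => exact (ih fun s hs => hst s (by omega)).succ hn h (hst t (by omega))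

/-- Consequently, overwriting a nonzero deviation is always a repeated selection; this links the
total deviation to `repeats`. -/
theorem exists_of_err_ne_zero {t : ℕ} {i : Fin n} (h : err a ε γ κ t i ≠ 0) :
    ∃ s < t, κ s = i := by
  induction t with
  | zero => simp [err, deviation, memRun] at h
  | succ t ih =>
    by_cases hi : i = κ t
    · exact ⟨t, by omega, hi.symm⟩
    · rw [err_succ_of_ne hi] at h
      obtain ⟨s, hs, h⟩ := ih h
      exact ⟨s, by omega, h⟩

theorem errSum_succ (t : ℕ) : errSum a ε γ κ (t + 1) =
    errSum a ε γ κ t - err a ε γ κ t (κ t) + err a ε γ κ (t + 1) (κ t) := by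
  have h : errSum a ε γ κ (t + 1) - errSum a ε γ κ t =
      err a ε γ κ (t + 1) (κ t) - err a ε γ κ t (κ t) := by
    rw [errSum, errSum, ← Finset.sum_sub_distrib, Finset.sum_eq_single (κ t)]
    · intro i _ hi
      rw [err_succ_of_ne hi, sub_self]
    · simp
  linarith

end MemRun

end SACD
-- Realisation of the memory process by an asynchronous schedule.
namespace SACD

open FlipState

namespace Schedule

variable {n T : ℕ} (S : Schedule n T) (F : (Fin n → ℝ) → ℝ) (Γ : ℝ) (x₀ : Fin n → ℝ)
  (k : Fin T → Fin n)

theorem memory_succ_of_commit {r : ℕ} {t : Fin T} (ht : S.commit k t = r) :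
    S.memory F Γ x₀ k (r + 1) = Function.update (S.memory F Γ x₀ k r) (k t)
      (S.memory F Γ x₀ k r (k t) -
        partialDeriv F (k t) (fun i => S.memory F Γ x₀ k (S.readTime k t i) i) / Γ) := by
  funext j
  rw [memory_succ]
  by_cases hj : j = k t
  · subst hj
    have : Finset.univ.filter (fun s : Fin T => S.commit k s = r ∧ k s = k t) = {t} := by
      ext s
      simp only [Finset.mem_filter, Finset.mem_univ, true_and, Finset.mem_singleton]
      exact ⟨fun h => S.commit_injective k (h.1.trans ht.symm), by rintro rfl; exact ⟨ht, rfl⟩⟩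
    rw [this, Finset.sum_singleton, Function.update_self]
  · have : Finset.univ.filter (fun s : Fin T => S.commit k s = r ∧ k s = j) = ∅ := by
      ext s
      simp only [Finset.mem_filter, Finset.mem_univ, true_and, Finset.notMem_empty, iff_false]
      rintro ⟨h1, h2⟩
      exact hj (S.commit_injective k (h1.trans ht.symm) ▸ h2.symm)
    rw [this, Finset.sum_empty, sub_zero, Function.update_of_ne hj]

theorem memory_succ_of_ne {r : ℕ} (h : ∀ t, S.commit k t ≠ r) :
    S.memory F Γ x₀ k (r + 1) = S.memory F Γ x₀ k r := by
  funext j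
  rw [memory_succ, Finset.filter_false_of_mem fun s _ hs => h s hs.1, Finset.sum_empty, sub_zero]

theorem exists_point_eq {t b : ℕ} (h : t ≤ (Finset.univ.filter fun s => S.commit k s < b).card) :
    ∃ r ≤ b, S.point F Γ x₀ k t = S.memory F Γ x₀ k r :=
  ⟨_, Nat.sInf_le h, rfl⟩

theorem point_eq {t b : ℕ} (h : t ≤ (Finset.univ.filter fun s => S.commit k s < b).card)
    (h' : ∀ r < b, (Finset.univ.filter fun s => S.commit k s < r).card < t) :
    S.point F Γ x₀ k t = S.memory F Γ x₀ k b := by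
  have : sInf {r : ℕ | t ≤ (Finset.univ.filter fun s : Fin T => S.commit k s < r).card} = b := by
    refine le_antisymm (Nat.sInf_le (by exact h)) (le_csInf ⟨b, h⟩ fun r hr => ?_)
    by_contra hlt
    exact absurd (h' r (by omega)) (not_lt.2 hr)
  rw [point, this]

end Schedule

section Adversary

variable {n : ℕ} [NeZero n] {T : ℕ}

/-- The selected coordinates, as an infinite sequence. -/
def extend (k : Fin T → Fin n) (t : ℕ) : Fin n := if h : t < T then k ⟨t, h⟩ else 0

theorem extend_coe (k : Fin T → Fin n) (t : Fin T) : extend k t = k t := by simp [extend]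

theorem extend_eq_of_forall {k k' : Fin T → Fin n} {c : ℕ}
    (h : ∀ s : Fin T, (s : ℕ) ≤ c → k s = k' s) {s : ℕ} (hs : s ≤ c) :
    extend k s = extend k' s := by
  unfold extend
  split_ifs with hT
  · exact h ⟨s, hT⟩ hs
  · rfl

open Classical in
/-- The time after which update `t` commits. -/
noncomputable def commitTime (a : ℕ) (κ : ℕ → Fin n) (t : ℕ) : ℕ :=
  -- Early flips occupy the times in `[a, 2a)`, all other updates the times from `2a` on, in the
  -- order of their starts.
  if IsEarly a κ t then t + a else t + 2 * a

open Classical in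
/-- The time at which update `t` reads the coordinate `j`. -/
noncomputable def readTimeAt (a : ℕ) (ε γ : ℝ) (κ : ℕ → Fin n) (t : ℕ) (j : Fin n) : ℕ :=
  if IsEarly a κ t then t
  else if j ∈ oldReads a ε γ κ (memRun a ε γ κ t) t then
    -- `thaw j - a - 1` is the index of the last flip of `j`. That flip commits half a unit after
    -- its `commitTime`, so the read sees the value just before it.
    commitTime a κ ((run a κ (max t a)).thaw j - a - 1)
  else t + 2 * a

variable {a : ℕ} {ε γ : ℝ} {κ : ℕ → Fin n}

omit [NeZero n] in
theorem commitTime_congr {κ' : ℕ → Fin n} {t : ℕ} (h : ∀ s ≤ t, κ s = κ' s) :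
    commitTime a κ t = commitTime a κ' t := by
  unfold commitTime
  rw [propext (isEarly_congr (a := a) h)]

omit [NeZero n] in
theorem readTimeAt_congr {κ' : ℕ → Fin n} {t : ℕ} (h : ∀ s ≤ commitTime a κ t, κ s = κ' s) :
    readTimeAt a ε γ κ t = readTimeAt a ε γ κ' t := by
  funext j
  have ht : t ≤ commitTime a κ t := by unfold commitTime; split_ifs <;> omega
  have he : IsEarly a κ t ↔ IsEarly a κ' t := isEarly_congr fun s hs => h s (hs.trans ht)
  by_cases hE : IsEarly a κ t
  · rw [readTimeAt, readTimeAt, if_pos hE, if_pos (he.1 hE)]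
  · rw [commitTime, if_neg hE] at h
    rw [readTimeAt, readTimeAt, if_neg hE, if_neg (mt he.2 hE),
      memRun_congr (κ := κ) (κ' := κ') fun s hs => h s (by omega),
      oldReads_congr (κ := κ) (κ' := κ') _ fun s hs => h s (by omega),
      run_congr (κ := κ) (κ' := κ') (t := max t a) fun s hs => h s (by omega)]
    split_ifs with hj
    · obtain ⟨s, hs, _, _, _, h5⟩ := exists_flipsAt_of_mem_recent (oldReads_subset _ _ _ _ _ _ hj)
      exact commitTime_congr fun s' hs' => h s' (by omega)
    · rfl

omit [NeZero n] in
-- A flip `s` that is recent at `max t a` has `t ≤ s + a`, and every update takes at least `a` units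
-- to commit, so the old value is still in memory when update `t` starts.
theorem le_readTimeAt (t : ℕ) (j : Fin n) : t ≤ readTimeAt a ε γ κ t j := by
  unfold readTimeAt
  split_ifs with h1 h2
  · exact le_rfl
  · obtain ⟨s, hs, _, h3, _, h5⟩ := exists_flipsAt_of_mem_recent (oldReads_subset _ _ _ _ _ _ h2)
    rw [h5, commitTime]
    split_ifs with h4 <;> omega
  · omega

omit [NeZero n] in
-- An early flip commits before `2a`; a later recent flip `s` satisfies `s < t` and has the same
-- delay as update `t`.
theorem readTimeAt_le (t : ℕ) (j : Fin n) : readTimeAt a ε γ κ t j ≤ commitTime a κ t := by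
  unfold readTimeAt
  split_ifs with h1 h2
  · rw [commitTime, if_pos h1]
    omega
  · obtain ⟨s, hs, _, h3, _, h5⟩ := exists_flipsAt_of_mem_recent (oldReads_subset _ _ _ _ _ _ h2)
    have e : s + a + 1 - a - 1 = s := by omega
    rw [h5, e, commitTime, commitTime, if_neg h1]
    split_ifs with h4
    · have := h4.1
      omega
    · have : a ≤ s := by
        by_contra h
        exact h4 ⟨by omega, h3⟩
      omega
  · rw [commitTime, if_neg h1]

omit [NeZero n] in
theorem commitTime_injective (a : ℕ) (κ : ℕ → Fin n) : Function.Injective (commitTime a κ) := by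
  intro s t h
  unfold commitTime at h
  split_ifs at h with h1 h2 h2
  · omega
  · have := h1.1
    omega
  · have := h2.1
    omega
  · omega

omit [NeZero n] in
theorem le_commitTime (t : ℕ) : t ≤ commitTime a κ t := by
  unfold commitTime
  split_ifs <;> omega

omit [NeZero n] in
theorem commitTime_le (t : ℕ) : commitTime a κ t ≤ t + 2 * a := by
  unfold commitTime
  split_ifs <;> omega

variable (n T a ε γ) in
/-- The schedule that makes coordinate descent stall. -/
noncomputable def stallingSchedule : Schedule n T where
  commit k t := commitTime a (extend k) t
  readTime k t := readTimeAt a ε γ (extend k) t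
  start_le_commit _ t := le_commitTime _
  commit_injective k s t h := Fin.ext (commitTime_injective a _ h)
  start_le_readTime k t j := le_readTimeAt _ _
  readTime_le_commit k t j := readTimeAt_le _ _
  adapted k k' t h := by
    refine ⟨(commitTime_congr fun s hs => extend_eq_of_forall h ?_).symm,
      (readTimeAt_congr fun s hs => extend_eq_of_forall h hs).symm⟩
    exact hs.trans (le_commitTime _)

/-- Timespans are at most `2a` long, so overlapping updates have starts at most `2a` apart: `2a`
candidates on either side. -/
theorem isBounded_stallingSchedule {q : ℕ} (hq : 4 * a ≤ q) :
    (stallingSchedule n T a ε γ).IsBounded q := by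
  intro k t
  refine le_trans ?_ hq
  refine (Finset.card_le_card_of_injOn (t := (Finset.Icc ((t : ℕ) - 2 * a) (t + 2 * a)).erase t)
    (fun s : Fin T => (s : ℕ)) ?_ fun s _ s' _ h => Fin.ext h).trans ?_
  · intro s hs
    simp only [Finset.coe_filter, Finset.mem_univ, true_and, Set.mem_ofPred_eq] at hs
    have h1 : (s : ℕ) ≤ t + 2 * a := hs.2.1.trans (commitTime_le _)
    have h2 : (t : ℕ) ≤ s + 2 * a := hs.2.2.trans (commitTime_le _)
    simp only [Finset.coe_erase, Finset.coe_Icc, Set.mem_sdiff, Set.mem_Icc,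
      Set.mem_singleton_iff]
    exact ⟨by omega, fun h => hs.1 (Fin.ext h)⟩
  · rw [Finset.card_erase_of_mem (by simp), Nat.card_Icc]
    omega

variable {L Γ : ℝ} (k : Fin T → Fin n)

variable (a ε L Γ) in
/-- The content of the memory in the run of the stalling schedule. -/
noncomputable def stallingMemory (r : ℕ) : Fin n → ℝ :=
  (stallingSchedule n T a ε (Γ / L)).memory (fun x => L * fEps ε x) Γ (startPoint n) k r

omit [NeZero n] in
theorem partialDeriv_div (hL : L ≠ 0) (j : Fin n) (x : Fin n → ℝ) :
    partialDeriv (fun x : Fin n → ℝ => L * fEps ε x) j x / Γ =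
      ((1 - ε) * x j + ε * ∑ i, x i) / (Γ / L) := by
  rw [partialDeriv_mul_fEps]
  field_simp

theorem stallingMemory_of_le {r : ℕ} (hr : r ≤ a) :
    stallingMemory a ε L Γ k r = startPoint n := by
  induction r with
  | zero => rfl
  | succ r ih =>
    rw [← ih (by omega)]
    refine Schedule.memory_succ_of_ne _ _ _ _ _ fun t ht => ?_
    change commitTime a (extend k) t = r at ht
    unfold commitTime at ht
    split_ifs at ht <;> omega

/-- Early updates read `x⁰`, whose coordinates sum to zero, so the step is exactly `-α x⁰_j` and
lands on the second ideal value without steering. -/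
theorem stallingMemory_add (hn : Even n) (hL : L ≠ 0) (haT : a ≤ T) {s : ℕ} (hs : s ≤ a) :
    stallingMemory a ε L Γ k (a + s) = fun i =>
      ideal (alpha ε (Γ / L)) i ((run a (extend k) s).flipped i) := by
  induction s with
  | zero =>
    rw [stallingMemory_of_le k (by omega)]
    funext i
    simp [run, ideal]
  | succ s ih =>
    have ih := ih (by omega)
    by_cases he : IsEarly a (extend k) s
    · have hstep := (stallingSchedule n T a ε (Γ / L)).memory_succ_of_commit
        (fun x => L * fEps ε x) Γ (startPoint n) k (r := a + s) (t := ⟨s, by omega⟩)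
        (by change commitTime a (extend k) s = a + s; rw [commitTime, if_pos he, add_comm])
      have hk : k ⟨s, by omega⟩ = extend k s := (extend_coe k ⟨s, by omega⟩).symm
      have hread : (fun i => (stallingSchedule n T a ε (Γ / L)).memory (fun x => L * fEps ε x) Γ
          (startPoint n) k ((stallingSchedule n T a ε (Γ / L)).readTime k ⟨s, by omega⟩ i) i) =
          startPoint n := by
        funext i
        have : (stallingSchedule n T a ε (Γ / L)).readTime k ⟨s, by omega⟩ i = s := by
          change readTimeAt a ε (Γ / L) (extend k) s i = s
          rw [readTimeAt, if_pos he]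
        rw [this]
        exact congrFun (stallingMemory_of_le k (by omega)) i
      rw [hread, hk, partialDeriv_div hL, sum_startPoint hn] at hstep
      change stallingMemory a ε L Γ k (a + s + 1) = Function.update (stallingMemory a ε L Γ k (a + s))
        (extend k s) (stallingMemory a ε L Γ k (a + s) (extend k s) - _) at hstep
      rw [← add_assoc, hstep, ih, run_succ_of_flipsAt he.2]
      funext i
      by_cases hi : i = extend k s
      · subst hi
        simp only [Function.update_self, flipped_eq_false_of_flipsAt he.1 he.2, ideal, alpha]
        simp only [Bool.false_eq_true, if_false, Bool.not_false, if_true]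
        ring
      · simp only [Function.update_of_ne hi]
    · have hf : ¬FlipsAt a (extend k) s := fun h => he ⟨by omega, h⟩
      rw [run_succ_of_not_flipsAt hf, ← ih, ← add_assoc]
      refine Schedule.memory_succ_of_ne _ _ _ _ _ fun t ht => ?_
      change commitTime a (extend k) t = a + s at ht
      unfold commitTime at ht
      split_ifs at ht with h1
      · have : (t : ℕ) = s := by omega
        exact he (this ▸ h1)
      · omega

/-- From time `2a` on, one update commits per time unit in the order of starts, the slots of early
updates staying empty. The second clause is carried along because later updates read these old
values. -/
theorem stallingMemory_two_mul_add (hn : Even n) (hL : L ≠ 0) (haT : a ≤ T) {t : ℕ}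
    (ht : t ≤ T) :
    stallingMemory a ε L Γ k (2 * a + t) = (memRun a ε (Γ / L) (extend k) t).cur ∧
      ∀ i ∈ (run a (extend k) (max t a)).recent (max t a),
        stallingMemory a ε L Γ k (commitTime a (extend k)
          ((run a (extend k) (max t a)).thaw i - a - 1)) i =
        (memRun a ε (Γ / L) (extend k) t).old i := by
  induction t with
  | zero =>
    constructor
    · rw [add_zero, two_mul, stallingMemory_add k hn hL haT le_rfl, memRun]
    · intro i hi
      obtain ⟨s, hs, _, h3, h4, h5⟩ := exists_flipsAt_of_mem_recent hi
      have hsa : s < a := by omega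
      have e : s + a + 1 - a - 1 = s := by omega
      rw [h5, e, commitTime, if_pos ⟨hsa, h3⟩, add_comm, stallingMemory_add k hn hL haT hsa.le,
        ← h4]
      simp [memRun, ideal, flipped_eq_false_of_flipsAt hsa h3]
  | succ t ih =>
    obtain ⟨ih1, ih2⟩ := ih (by omega)
    by_cases he : IsEarly a (extend k) t
    · have hta := he.1
      have hmax : max (t + 1) a = max t a := by omega
      rw [memRun_succ_of_isEarly he, hmax, ← ih1]
      refine ⟨Schedule.memory_succ_of_ne _ _ _ _ _ fun s hs => ?_, ih2⟩
      change commitTime a (extend k) s = 2 * a + t at hs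
      unfold commitTime at hs
      split_ifs at hs with h1
      · have := h1.1
        omega
      · have : (s : ℕ) = t := by omega
        exact h1 (this ▸ he)
    · constructor
      · have hstep := (stallingSchedule n T a ε (Γ / L)).memory_succ_of_commit
          (fun x => L * fEps ε x) Γ (startPoint n) k (r := 2 * a + t) (t := ⟨t, by omega⟩)
          (by change commitTime a (extend k) t = 2 * a + t; rw [commitTime, if_neg he, add_comm])
        have hk : k ⟨t, by omega⟩ = extend k t := (extend_coe k ⟨t, by omega⟩).symm
        have hread : (fun i => (stallingSchedule n T a ε (Γ / L)).memory (fun x => L * fEps ε x) Γ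
            (startPoint n) k ((stallingSchedule n T a ε (Γ / L)).readTime k ⟨t, by omega⟩ i) i) =
            fun i => if i ∈ oldReads a ε (Γ / L) (extend k) (memRun a ε (Γ / L) (extend k) t) t
              then (memRun a ε (Γ / L) (extend k) t).old i
              else (memRun a ε (Γ / L) (extend k) t).cur i := by
          funext i
          change stallingMemory a ε L Γ k (readTimeAt a ε (Γ / L) (extend k) t i) i = _
          rw [readTimeAt, if_neg he]
          split_ifs with hi
          · exact ih2 i (oldReads_subset _ _ _ _ _ _ hi)
          · rw [add_comm, ih1]
        rw [hread, hk, partialDeriv_div hL] at hstep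
        change stallingMemory a ε L Γ k (2 * a + t + 1) =
          Function.update (stallingMemory a ε L Γ k (2 * a + t))
          (extend k t) (stallingMemory a ε L Γ k (2 * a + t) (extend k t) - _) at hstep
        rw [← add_assoc, hstep, ih1, memRun_succ_cur he, newValue,
          if_neg (notMem_oldReads _ _ _ _ _ _)]
      · intro i hi
        rcases Nat.lt_or_ge t a with hta | hta
        · have hmax : max (t + 1) a = max t a := by omega
          rw [hmax] at hi ⊢
          rw [memRun_succ_old_of_not (by omega)]
          exact ih2 i hi
        · rw [max_eq_left hta] at ih2
          rw [max_eq_left (by omega)] at hi ⊢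
          by_cases hf : FlipsAt a (extend k) t
          · rw [memRun_succ_old_of_flipsAt hta hf]
            rw [run_succ_of_flipsAt hf] at hi ⊢
            by_cases hik : i = extend k t
            · subst hik
              have e : t + a + 1 - a - 1 = t := by omega
              simp only [Function.update_self]
              rw [e, commitTime, if_neg he, add_comm, ih1]
            · rw [mem_recent] at hi
              simp only [Function.update_of_ne hik] at hi ⊢
              exact ih2 i (mem_recent.2 (by omega))
          · rw [memRun_succ_old_of_not (by tauto)]
            rw [run_succ_of_not_flipsAt hf, mem_recent] at hi
            rw [run_succ_of_not_flipsAt hf]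
            exact ih2 i (mem_recent.2 (by omega))

/-- Up to time `2a` the memory is exactly ideal. The relation between `m` and `r` is recorded so
that the lower bound for `f_ε` can compare the numbers of flipped coordinates. -/
theorem exists_stallingMemory (hn : Even n) (hL : L ≠ 0) (haT : a ≤ T) {F B : ℝ}
    (h : Regime ε (Γ / L) F B) (hst : ∀ s < T, Steerable a ε (Γ / L) (extend k) F B s) {r : ℕ}
    (hr : r ≤ 2 * a + T) :
    ∃ m, (m ≤ a ∨ r = 2 * a + m) ∧ ∀ i,
      stallingMemory a ε L Γ k r i =
        ideal (alpha ε (Γ / L)) i ((run a (extend k) m).flipped i) ∨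
      (2 / 3 * nu ε (Γ / L) ≤ |stallingMemory a ε L Γ k r i -
        ideal (alpha ε (Γ / L)) i ((run a (extend k) m).flipped i)| ∧
      |stallingMemory a ε L Γ k r i -
        ideal (alpha ε (Γ / L)) i ((run a (extend k) m).flipped i)| ≤ nu ε (Γ / L)) := by
  rcases Nat.lt_or_ge r (2 * a) with h1 | h1
  · rcases Nat.lt_or_ge r a with h2 | h2
    · refine ⟨0, .inl (by omega), fun i => .inl ?_⟩
      rw [stallingMemory_of_le k h2.le]
      simp [run, ideal]
    · obtain ⟨s, rfl⟩ := Nat.exists_eq_add_of_le h2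
      refine ⟨s, .inl (by omega), fun i => .inl ?_⟩
      rw [stallingMemory_add k hn hL haT (by omega)]
  · obtain ⟨t, rfl⟩ := Nat.exists_eq_add_of_le h1
    refine ⟨max t a, by omega, fun i => ?_⟩
    have := (stalls_of_steerable hn h (t := t) fun s hs => hst s (by omega)).err i
    rw [err, deviation] at this
    rw [(stallingMemory_two_mul_add k hn hL haT (by omega)).1, ← sub_eq_zero]
    exact this

theorem card_commit_lt_ge {t : ℕ} (ht : t ≤ T) : t ≤ (Finset.univ.filter fun s : Fin T =>
    (stallingSchedule n T a ε γ).commit k s < 2 * a + t).card := by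
  calc t = (Finset.univ : Finset (Fin t)).card := by simp
    _ ≤ _ := by
      refine Finset.card_le_card_of_injOn (fun s => Fin.castLE ht s) ?_
        fun _ _ _ _ h => Fin.castLE_injective ht h
      intro s _
      simp only [Finset.coe_filter, Finset.mem_univ, true_and, Set.mem_ofPred_eq]
      have : commitTime a (extend k) s ≤ s + 2 * a := commitTime_le _
      exact lt_of_le_of_lt this (by omega)

/-- Early flips may overtake other updates, but their indices are below `a < t`; hence from the `(a
+ 1)`-st commit on, the `t`-th commit is that in slot `2a + t - 1`. -/
theorem card_commit_lt_lt {t r : ℕ} (ht : a < t) (hr : r < 2 * a + t) :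
    (Finset.univ.filter fun s : Fin T => (stallingSchedule n T a ε γ).commit k s < r).card < t := by
  refine lt_of_le_of_lt (Finset.card_le_card_of_injOn (t := Finset.range (t - 1))
    (fun s : Fin T => (s : ℕ)) ?_ fun s _ s' _ h => Fin.ext h) (by simp; omega)
  intro s hs
  simp only [Finset.coe_filter, Finset.mem_univ, true_and, Set.mem_ofPred_eq] at hs
  change commitTime a (extend k) s < r at hs
  unfold commitTime at hs
  simp only [Finset.coe_range, Set.mem_Iio]
  split_ifs at hs with h1
  · have := h1.1
    omega
  · omega

/-- In a run in which all updates can be steered, every iterate is close to ideal values. -/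
theorem exists_point_stallingSchedule (hn : Even n) (hL : L ≠ 0) (haT : a ≤ T) {F B : ℝ}
    (h : Regime ε (Γ / L) F B) (hst : ∀ s < T, Steerable a ε (Γ / L) (extend k) F B s) {t : ℕ}
    (ht : t ≤ T) {x : Fin n → ℝ}
    (hx : (stallingSchedule n T a ε (Γ / L)).point (fun x => L * fEps ε x) Γ (startPoint n) k t =
      x) :
    ∃ m, (m ≤ a ∨ m = t) ∧ ∀ i,
      x i = ideal (alpha ε (Γ / L)) i ((run a (extend k) m).flipped i) ∨
      (2 / 3 * nu ε (Γ / L) ≤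
        |x i - ideal (alpha ε (Γ / L)) i ((run a (extend k) m).flipped i)| ∧
      |x i - ideal (alpha ε (Γ / L)) i ((run a (extend k) m).flipped i)| ≤ nu ε (Γ / L)) := by
  subst hx
  rcases Nat.lt_or_ge a t with h1 | h1
  · rw [Schedule.point_eq _ _ _ _ _ (card_commit_lt_ge k ht) fun r hr => card_commit_lt_lt k h1 hr]
    obtain ⟨m, hm, h2⟩ := exists_stallingMemory k hn hL haT h hst (r := 2 * a + t) (by omega)
    exact ⟨m, by omega, h2⟩
  · obtain ⟨r, hr, h3⟩ := Schedule.exists_point_eq (stallingSchedule n T a ε (Γ / L))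
      (fun x => L * fEps ε x) Γ (startPoint n) k (h1.trans (card_commit_lt_ge k haT))
    rw [h3]
    obtain ⟨m, hm, h2⟩ := exists_stallingMemory k hn hL haT h hst (r := r) (by omega)
    exact ⟨m, by omega, h2⟩

theorem stallsFor_stallingSchedule (hn : Even n) (hL : L ≠ 0) (haT : a ≤ T) {F B : ℝ}
    (h : Regime ε (Γ / L) F B) (hst : ∀ s < T, Steerable a ε (Γ / L) (extend k) F B s) :
    StallsFor (stallingSchedule n T a ε (Γ / L)) ε L Γ k T := by
  intro t ht j
  obtain ⟨m, _, h2⟩ := exists_point_stallingSchedule k hn hL haT h hst ht rfl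
  refine ⟨_, ?_, h2 j⟩
  unfold ideal
  split_ifs
  · exact .inr rfl
  · exact .inl (mul_one _)

/-- An unflipped coordinate lies within `ν ≤ 1/4` of `±1`, so its square is at least `(3/4)²`. The
loss of `a` covers iterates whose flip state is that of some time `m ≤ a`. -/
theorem fEps_point_ge (hn : Even n) (hL : L ≠ 0) (haT : a ≤ T) {F B : ℝ}
    (h : Regime ε (Γ / L) F B) (hst : ∀ s < T, Steerable a ε (Γ / L) (extend k) F B s) {t : ℕ}
    (ht : t ≤ T) :
    (1 - ε) / 2 * (9 / 16 * (n - a -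
      (Finset.univ.filter fun i => (run a (extend k) t).flipped i).card)) ≤
    fEps ε ((stallingSchedule n T a ε (Γ / L)).point (fun x => L * fEps ε x) Γ
      (startPoint n) k t) := by
  obtain ⟨m, hm, h2⟩ := exists_point_stallingSchedule k hn hL haT h hst ht rfl
  set x := (stallingSchedule n T a ε (Γ / L)).point (fun x => L * fEps ε x) Γ (startPoint n) k t
  refine le_trans ?_ (fEps_ge h.pos.le _)
  refine mul_le_mul_of_nonneg_left ?_ (by linarith [h.le])
  have hcard : (Finset.univ.filter fun i => (run a (extend k) m).flipped i).card ≤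
      a + (Finset.univ.filter fun i => (run a (extend k) t).flipped i).card := by
    rcases hm with hm | rfl
    · have := card_flipped_le (a := a) (κ := extend k) m
      omega
    · omega
  have hcard' : ((Finset.univ.filter fun i => (run a (extend k) m).flipped i).card : ℝ) ≤
      a + (Finset.univ.filter fun i => (run a (extend k) t).flipped i).card := by
    exact_mod_cast hcard
  have hsum : ∑ i : Fin n, (9 / 16 - if (run a (extend k) m).flipped i then 9 / 16 else 0) ≤
      ∑ i, x i ^ 2 := by
    refine Finset.sum_le_sum fun i _ => ?_
    split_ifs with hi
    · simpa using sq_nonneg (x i)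
    · have hd : |x i - startPoint n i| ≤ 1 / 4 := by
        have hν : nu ε (Γ / L) ≤ 1 / 4 := by linarith [h.nu_le, h.alpha_le_one]
        have := h2 i
        simp only [hi, ideal] at this
        rw [Bool.not_eq_true] at hi
        simp only [Bool.false_eq_true, if_false, mul_one] at this
        rcases this with h0 | h0
        · rw [h0, sub_self, abs_zero]
          norm_num
        · exact h0.2.trans hν
      have hd' := abs_le.1 hd
      rcases sq_eq_one_iff.1 (startPoint_sq i) with h1 | h1 <;> rw [h1] at hd' <;>
        nlinarith
  rw [Finset.sum_sub_distrib, ← Finset.sum_filter] at hsum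
  simp only [Finset.sum_const, Finset.card_univ, Fintype.card_fin, nsmul_eq_mul] at hsum
  linarith

end Adversary

end SACD
-- Exponential moments of the numbers of flips and repeats; the expected number of flipped
-- coordinates.
namespace SACD

open FlipState

section Expect

variable {n T : ℕ}

theorem expect_mono {g h : (Fin T → Fin n) → ℝ} (H : ∀ k, g k ≤ h k) : expect g ≤ expect h :=
  div_le_div_of_nonneg_right (Finset.sum_le_sum fun k _ => H k) (by positivity)

theorem expect_add (g h : (Fin T → Fin n) → ℝ) :
    expect (fun k => g k + h k) = expect g + expect h := by
  rw [expect, expect, expect, Finset.sum_add_distrib, add_div]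

theorem expect_const_mul (c : ℝ) (g : (Fin T → Fin n) → ℝ) :
    expect (fun k => c * g k) = c * expect g := by
  rw [expect, expect, ← Finset.mul_sum, mul_div_assoc]

theorem expect_const [NeZero n] (c : ℝ) : expect (fun _ : Fin T → Fin n => c) = c := by
  have : (n : ℝ) ≠ 0 := by exact_mod_cast NeZero.ne n
  simp [expect, this]

open Classical in
theorem prob_eq_expect (A : (Fin T → Fin n) → Prop) :
    prob A = expect fun k => if A k then 1 else 0 := by
  rw [prob, expect, Finset.sum_boole]

theorem prob_le_expect {A : (Fin T → Fin n) → Prop} {g : (Fin T → Fin n) → ℝ}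
    (h0 : ∀ k, 0 ≤ g k) (h1 : ∀ k, A k → 1 ≤ g k) : prob A ≤ expect g := by
  classical
  rw [prob_eq_expect]
  refine expect_mono fun k => ?_
  split_ifs with h
  · exact h1 k h
  · exact h0 k

theorem prob_mono {A A' : (Fin T → Fin n) → Prop} (h : ∀ k, A k → A' k) : prob A ≤ prob A' := by
  classical
  rw [prob_eq_expect A']
  refine prob_le_expect (fun k => by split_ifs <;> norm_num) fun k hk => ?_
  rw [if_pos (h k hk)]

theorem prob_or_le (A A' : (Fin T → Fin n) → Prop) :
    prob (fun k => A k ∨ A' k) ≤ prob A + prob A' := by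
  classical
  rw [prob_eq_expect A, prob_eq_expect A', ← expect_add]
  refine prob_le_expect (fun k => by split_ifs <;> norm_num) fun k hk => ?_
  rcases hk with hk | hk
  · rw [if_pos hk]
    split_ifs <;> norm_num
  · rw [if_pos hk]
    split_ifs <;> norm_num

theorem prob_exists_lt_le (A : ℕ → (Fin T → Fin n) → Prop) (N : ℕ) {p : ℝ}
    (h : ∀ s < N, prob (A s) ≤ p) : prob (fun k => ∃ s < N, A s k) ≤ N * p := by
  induction N with
  | zero => simp [prob]
  | succ N ih =>
    have h1 : prob (fun k => ∃ s < N + 1, A s k) ≤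
        prob (fun k => (∃ s < N, A s k) ∨ A N k) := by
      refine prob_mono fun k => ?_
      rintro ⟨s, hs, hk⟩
      rcases Nat.lt_succ_iff_lt_or_eq.1 hs with hs | rfl
      · exact .inl ⟨s, hs, hk⟩
      · exact .inr hk
    have h2 := prob_or_le (fun k => ∃ s < N, A s k) (A N)
    have h3 := ih fun s hs => h s (by omega)
    have h4 := h N (by omega)
    push_cast
    linarith

theorem prob_not [NeZero n] (A : (Fin T → Fin n) → Prop) : prob (fun k => ¬A k) = 1 - prob A := by
  classical
  have h : prob A + prob (fun k => ¬A k) = 1 := by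
    rw [prob_eq_expect A, prob_eq_expect fun k => ¬A k, ← expect_add]
    refine (congrArg expect (funext fun k => ?_)).trans (expect_const (n := n) (T := T) 1)
    split_ifs <;> norm_num
  linarith

/-- Bounding an expectation by first averaging over one of the selected coordinates. -/
theorem expect_le_of_sum_update_le [NeZero n] {G H : (Fin T → Fin n) → ℝ} (t : Fin T)
    (h : ∀ k, ∑ j, G (Function.update k t j) ≤ n * H k) : expect G ≤ expect H := by
  have hn : (0 : ℝ) < n := by exact_mod_cast NeZero.pos n
  have key : ∑ k : Fin T → Fin n, ∑ j, G (Function.update k t j) = n * ∑ k, G k := by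
    rw [← Fintype.sum_prod_type' (f := fun (k : Fin T → Fin n) (j : Fin n) =>
      G (Function.update k t j))]
    have e : ∑ p : (Fin T → Fin n) × Fin n, G (Function.update p.1 t p.2) =
        ∑ p : (Fin T → Fin n) × Fin n, G p.1 := by
      -- Exchanging entry `t` of the sequence with the extra coordinate is an involution.
      refine Finset.sum_nbij' (fun p => (Function.update p.1 t p.2, p.1 t))
        (fun p => (Function.update p.1 t p.2, p.1 t)) ?_ ?_ ?_ ?_ ?_ <;> simp
    rw [e, Fintype.sum_prod_type]
    simp [Finset.mul_sum]
  refine div_le_div_of_nonneg_right ?_ (by positivity)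
  refine le_of_mul_le_mul_left ?_ hn
  rw [← key, Finset.mul_sum]
  exact Finset.sum_le_sum fun k _ => h k

end Expect

section Selection

variable {n : ℕ} [NeZero n] {T : ℕ}

theorem extend_update (k : Fin T → Fin n) (t : Fin T) (j : Fin n) :
    extend (Function.update k t j) = Function.update (extend k) t j := by
  funext s
  by_cases hs : s = t
  · subst hs
    rw [extend_coe]
    simp
  · rw [Function.update_of_ne hs]
    unfold extend
    split_ifs with hT
    · rw [Function.update_of_ne fun h => hs (by rw [← h])]
    · rfl

theorem extend_update_of_lt (k : Fin T → Fin n) (t : Fin T) (j : Fin n) {s : ℕ} (hs : s < t) :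
    extend (Function.update k t j) s = extend k s := by
  rw [extend_update, Function.update_of_ne hs.ne]

theorem extend_update_self (k : Fin T → Fin n) (t : Fin T) (j : Fin n) :
    extend (Function.update k t j) t = j := by
  rw [extend_update, Function.update_self]

variable {a : ℕ}

theorem run_update (k : Fin T → Fin n) (t : Fin T) (j : Fin n) {s : ℕ} (hs : s ≤ t) :
    run a (extend (Function.update k t j)) s = run a (extend k) s :=
  run_congr fun _ h => extend_update_of_lt k t j (by omega)

theorem run_update_succ (k : Fin T → Fin n) (t : Fin T) (j : Fin n) :
    run a (extend (Function.update k t j)) (t + 1) = (run a (extend k) t).next a t j := by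
  rw [run, run_update k t j le_rfl, extend_update_self]

-- The imbalance of flipped coordinates is `0` or `-1`, so upward and downward candidates are always
-- almost equally many, and the direction that is due has at least `n / 2`.
omit [NeZero n] in
open Classical in
theorem card_isUp (hn : Even n) (κ : ℕ → Fin n) (t : ℕ) :
    ((Finset.univ.filter (run a κ t).IsUp).card : ℝ) =
      n / 2 + if Even (run a κ t).count then 0 else -1 := by
  rw [← sum_startPoint_mul_flipped, ← Finset.sum_boole]
  have : ∀ i : Fin n, (if (run a κ t).IsUp i then (1 : ℝ) else 0) = 1 / 2 - startPoint n i / 2 +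
      startPoint n i * if (run a κ t).flipped i then 1 else 0 := by
    intro i
    unfold startPoint IsUp
    cases (run a κ t).flipped i <;> by_cases h : Even (i : ℕ) <;> simp [h] <;> norm_num
  simp only [this, Finset.sum_add_distrib, Finset.sum_sub_distrib, ← Finset.sum_div,
    sum_startPoint hn]
  simp

-- At least `n / 2` coordinates have the direction that is due, and at most `a` of them are frozen.
omit [NeZero n] in
open Classical in
theorem card_flips_ge (hn : Even n) (κ : ℕ → Fin n) (t : ℕ) :
    (n : ℝ) / 2 - a ≤ (Finset.univ.filter ((run a κ t).Flips t)).card := by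
  have h1 : (n : ℝ) / 2 ≤
      (Finset.univ.filter fun i => Even (run a κ t).count ↔ (run a κ t).IsUp i).card := by
    have h := card_isUp (a := a) hn κ t
    by_cases he : Even (run a κ t).count
    · simp only [he, true_iff, if_true] at h ⊢
      linarith
    · simp only [he, false_iff, if_false] at h ⊢
      have h2 := Finset.card_filter_add_card_filter_not (s := (Finset.univ : Finset (Fin n)))
        (run a κ t).IsUp
      rw [Finset.card_univ, Fintype.card_fin] at h2
      have h2' : ((Finset.univ.filter (run a κ t).IsUp).card : ℝ) +
        (Finset.univ.filter fun i => ¬(run a κ t).IsUp i).card = n := by exact_mod_cast h2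
      linarith
  have h2 : (Finset.univ.filter fun i => Even (run a κ t).count ↔ (run a κ t).IsUp i) ⊆
      (Finset.univ.filter ((run a κ t).Flips t)) ∪ (run a κ t).recent t := by
    intro i hi
    simp only [Finset.mem_filter, Finset.mem_univ, true_and, Finset.mem_union, mem_recent] at hi ⊢
    rcases Nat.lt_or_ge t ((run a κ t).thaw i) with h | h
    · exact .inr h
    · exact .inl ⟨h, hi⟩
  have h3 := (Finset.card_le_card h2).trans (Finset.card_union_le _ _)
  have h4 := card_recent_le (a := a) (κ := κ) t
  have h5 : ((Finset.univ.filter fun i => Even (run a κ t).count ↔ (run a κ t).IsUp i).card : ℝ) ≤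
    (Finset.univ.filter ((run a κ t).Flips t)).card + a := by exact_mod_cast h3.trans (by omega)
  linarith

/-- Upper bound for the factor by which `exp (-N / 2)`, for the number `N` of flips, shrinks
in expectation with each update. -/
noncomputable def flipRate (n a : ℕ) : ℝ := 1 - (1 - Real.exp (-(1 / 2))) * (1 / 2 - a / n)

theorem flipRate_nonneg (n a : ℕ) : 0 ≤ flipRate n a := by
  have h1 : 0 < Real.exp (-(1 / 2)) := Real.exp_pos _
  have h2 : Real.exp (-(1 / 2)) ≤ 1 := Real.exp_le_one_iff.2 (by norm_num)
  have h3 : (0 : ℝ) ≤ a / n := by positivity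
  rw [flipRate]
  nlinarith

/-- Chernoff argument: whatever the past, a flip occurs with probability at least `1/2 - a/n`, and
it multiplies the exponential by `exp (-1/2)`. -/
theorem expect_exp_count_le (hn : Even n) (w m : ℕ) (hm : w + m ≤ T) :
    expect (fun k : Fin T → Fin n => Real.exp (-((((run a (extend k) (w + m)).count : ℝ) -
      (run a (extend k) w).count) / 2))) ≤ flipRate n a ^ m := by
  classical
  have hn0 : (0 : ℝ) < n := by exact_mod_cast NeZero.pos n
  induction m with
  | zero => simp [expect_const]
  | succ m ih =>
    rw [pow_succ']
    refine le_trans ?_ (mul_le_mul_of_nonneg_left (ih (by omega)) (flipRate_nonneg n a))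
    rw [← expect_const_mul]
    refine expect_le_of_sum_update_le ⟨w + m, by omega⟩ fun k => ?_
    have hstep : ∀ j, Real.exp (-((((run a (extend (Function.update k ⟨w + m, by omega⟩ j))
        (w + (m + 1))).count : ℝ) -
        (run a (extend (Function.update k ⟨w + m, by omega⟩ j)) w).count) / 2)) =
        Real.exp (-((((run a (extend k) (w + m)).count : ℝ) - (run a (extend k) w).count) / 2)) *
          (1 - if (run a (extend k) (w + m)).Flips (w + m) j then
            1 - Real.exp (-(1 / 2)) else 0) := by
      intro j
      rw [run_update (a := a) k ⟨w + m, by omega⟩ j (by simp : w ≤ w + m), ← add_assoc,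
        run_update_succ (a := a) k ⟨w + m, by omega⟩ j, next]
      split_ifs
      · rw [sub_sub_cancel, ← Real.exp_add]
        congr 1
        push_cast
        ring
      · rw [sub_zero, mul_one]
    simp only [hstep]
    rw [← Finset.mul_sum, Finset.sum_sub_distrib, ← Finset.sum_filter, Finset.sum_const,
      Finset.sum_const, Finset.card_univ, Fintype.card_fin, nsmul_eq_mul, nsmul_eq_mul, mul_one,
      mul_left_comm, mul_comm]
    rw [mul_left_comm, ← mul_assoc]
    refine mul_le_mul_of_nonneg_right ?_ (Real.exp_pos _).le
    have h1 := card_flips_ge (a := a) hn (extend k) (w + m)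
    have h2 : Real.exp (-(1 / 2)) ≤ 1 := Real.exp_le_one_iff.2 (by norm_num)
    have h3 := mul_le_mul_of_nonneg_right h1 (sub_nonneg.2 h2)
    have h4 : flipRate n a * n = n - (n / 2 - a) * (1 - Real.exp (-(1 / 2))) := by
      rw [flipRate]
      field_simp
    linarith

theorem prob_count_lt_le (hn : Even n) (F : ℝ) {τ : ℕ} (h1 : a ≤ τ) (h2 : τ ≤ T) :
    prob (fun k : Fin T → Fin n => ¬((run a (extend k) (τ - a)).count + F ≤
      (run a (extend k) τ).count)) ≤ Real.exp (F / 2) * flipRate n a ^ a := by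
  have h := expect_exp_count_le (n := n) (T := T) (a := a) hn (τ - a) a (by omega)
  rw [Nat.sub_add_cancel h1] at h
  refine le_trans ?_ (mul_le_mul_of_nonneg_left h (Real.exp_pos _).le)
  rw [← expect_const_mul]
  refine prob_le_expect (fun k => by positivity) fun k hk => ?_
  rw [← Real.exp_add, Real.one_le_exp_iff]
  linarith

open Classical in
/-- The number of times that a coordinate is selected again. -/
noncomputable def repeats (κ : ℕ → Fin n) (t : ℕ) : ℕ :=
  ((Finset.range t).filter fun s => ∃ s' < s, κ s' = κ s).card

omit [NeZero n] in
open Classical in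
theorem repeats_succ (κ : ℕ → Fin n) (t : ℕ) :
    repeats κ (t + 1) = repeats κ t + if ∃ s < t, κ s = κ t then 1 else 0 := by
  rw [repeats, repeats, Finset.range_add_one, Finset.filter_insert]
  split_ifs
  · rw [Finset.card_insert_of_notMem (by simp)]
  · rw [add_zero]

omit [NeZero n] in
theorem repeats_mono (κ : ℕ → Fin n) : Monotone (repeats κ) :=
  monotone_nat_of_le_succ fun t => by
    classical
    rw [repeats_succ]
    omega

omit [NeZero n] in
theorem repeats_congr {κ κ' : ℕ → Fin n} {t : ℕ} (h : ∀ s < t, κ s = κ' s) :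
    repeats κ t = repeats κ' t := by
  classical
  unfold repeats
  congr 1
  refine Finset.filter_congr fun s hs => ?_
  rw [Finset.mem_range] at hs
  refine exists_congr fun s' => and_congr_right fun hs' => ?_
  rw [h s hs, h s' (by omega)]

/-- Each of the first `t` selections repeats an earlier one with conditional probability at most `t
/ n`, giving a factor `1 + (e - 1) t / n ≤ exp (2t / n)`. -/
theorem expect_exp_repeats_le (t : ℕ) (ht : t ≤ T) :
    expect (fun k : Fin T → Fin n => Real.exp (repeats (extend k) t)) ≤
      Real.exp (2 * t / n * t) := by
  classical
  have hn0 : (0 : ℝ) < n := by exact_mod_cast NeZero.pos n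
  suffices h : ∀ m ≤ t, expect (fun k : Fin T → Fin n => Real.exp (repeats (extend k) m)) ≤
      Real.exp (2 * t / n) ^ m by
    refine (h t le_rfl).trans_eq ?_
    rw [← Real.exp_nat_mul, mul_comm]
  intro m hm
  induction m with
  | zero => simp [repeats, expect_const]
  | succ m ih =>
    rw [pow_succ']
    refine le_trans ?_ (mul_le_mul_of_nonneg_left (ih (by omega)) (Real.exp_pos _).le)
    rw [← expect_const_mul]
    refine expect_le_of_sum_update_le ⟨m, by omega⟩ fun k => ?_
    have hstep : ∀ j, Real.exp (repeats (extend (Function.update k ⟨m, by omega⟩ j)) (m + 1)) =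
        Real.exp (repeats (extend k) m) *
          (1 + if j ∈ (Finset.range m).image (extend k) then Real.exp 1 - 1 else 0) := by
      intro j
      have h1 : repeats (extend (Function.update k ⟨m, by omega⟩ j)) m = repeats (extend k) m :=
        repeats_congr fun s hs => extend_update_of_lt k ⟨m, by omega⟩ j hs
      have h2 : extend (Function.update k ⟨m, by omega⟩ j) m = j :=
        extend_update_self k ⟨m, by omega⟩ j
      have h3 : (∃ s < m, extend (Function.update k ⟨m, by omega⟩ j) s =
          extend (Function.update k ⟨m, by omega⟩ j) m) ↔
          j ∈ (Finset.range m).image (extend k) := by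
        rw [h2, Finset.mem_image]
        refine exists_congr fun s => ?_
        rw [Finset.mem_range]
        refine and_congr_right fun hs => ?_
        rw [extend_update_of_lt k ⟨m, by omega⟩ j hs]
      rw [repeats_succ, h1, if_congr h3 rfl rfl]
      split_ifs
      · push_cast
        rw [Real.exp_add]
        ring
      · simp
    simp only [hstep]
    rw [← Finset.mul_sum, Finset.sum_add_distrib, ← Finset.sum_filter, Finset.sum_const,
      Finset.sum_const, Finset.card_univ, Fintype.card_fin, nsmul_eq_mul, nsmul_eq_mul, mul_one,
      Finset.filter_mem_eq_inter, Finset.univ_inter, ← mul_assoc, mul_comm]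
    refine mul_le_mul_of_nonneg_right ?_ (Real.exp_pos _).le
    have h1 : (((Finset.range m).image (extend k)).card : ℝ) ≤ t := by
      have := (Finset.card_image_le (s := Finset.range m) (f := extend k)).trans_eq
        (Finset.card_range m)
      exact_mod_cast this.trans (by omega)
    have h2 : Real.exp 1 - 1 ≤ 2 := by linarith [Real.exp_one_lt_d9]
    have h3 : 0 ≤ Real.exp 1 - 1 := by linarith [Real.add_one_le_exp 1]
    have h4 := Real.add_one_le_exp (2 * t / n : ℝ)
    have h5 : (n : ℝ) * (2 * t / n + 1) = n + t * 2 := by field_simp; ring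
    have h6 := mul_le_mul h1 h2 h3 (by positivity)
    have h7 := mul_le_mul_of_nonneg_left h4 hn0.le
    linarith

end Selection

section Flipped

variable {n : ℕ} [NeZero n] {T a : ℕ}

omit [NeZero n] in
theorem card_flipped_eq (κ : ℕ → Fin n) (t : ℕ) :
    ((Finset.univ.filter fun i => (run a κ t).flipped i).card : ℝ) =
      ∑ i, if (run a κ t).flipped i then 1 else 0 := by
  rw [Finset.sum_boole]

omit [NeZero n] in
open Classical in
theorem sum_next_flipped (σ : FlipState n) (t : ℕ) (j : Fin n) :
    ∑ i, (if (σ.next a t j).flipped i then (1 : ℝ) else 0) =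
      ∑ i, (if σ.flipped i then (1 : ℝ) else 0) +
        if σ.Flips t j then 1 - 2 * (if σ.flipped j then 1 else 0) else 0 := by
  rw [next]
  by_cases h : σ.Flips t j
  · rw [if_pos h, if_pos h, ← sub_eq_iff_eq_add', ← Finset.sum_sub_distrib,
      Finset.sum_eq_single j]
    · cases σ.flipped j <;> simp
      norm_num
    · intro i _ hi
      simp [hi]
    · simp
  · rw [if_neg h, if_neg h, add_zero]

-- Without freezing, the candidates for a flip in either direction are the unflipped coordinates of
-- one parity and the flipped ones of the other, so the sum is exactly `n / 2` minus the number
-- flipped. Each frozen coordinate changes it by at most one.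
omit [NeZero n] in
open Classical in
theorem sum_flips_le (hn : Even n) (κ : ℕ → Fin n) (t : ℕ) :
    ∑ j, (if (run a κ t).Flips t j then 1 - 2 * (if (run a κ t).flipped j then (1 : ℝ) else 0)
      else 0) ≤ n / 2 - (∑ i, if (run a κ t).flipped i then (1 : ℝ) else 0) + a := by
  set σ := run a κ t
  have h1 : ∀ j, (if σ.Flips t j then 1 - 2 * (if σ.flipped j then (1 : ℝ) else 0) else 0) ≤
      (1 / 2 - (if Even σ.count then 1 else -1) * startPoint n j / 2 -
        if σ.flipped j then (1 : ℝ) else 0) + if j ∈ σ.recent t then 1 else 0 := by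
    intro j
    unfold Flips IsUp startPoint
    simp only [mem_recent, ← not_le]
    by_cases h2 : σ.thaw j ≤ t <;> by_cases h3 : Even σ.count <;> by_cases h4 : Even (j : ℕ) <;>
      cases σ.flipped j <;> simp [h2, h3, h4] <;> norm_num
  refine (Finset.sum_le_sum fun j _ => h1 j).trans ?_
  have h2 : ((σ.recent t).card : ℝ) ≤ a := by exact_mod_cast card_recent_le (a := a) (κ := κ) t
  simp only [Finset.sum_add_distrib, Finset.sum_sub_distrib, ← Finset.sum_div, ← Finset.mul_sum,
    sum_startPoint hn]
  have h3 : ∑ j, (if j ∈ σ.recent t then (1 : ℝ) else 0) = (σ.recent t).card := by simp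
  rw [h3]
  simp only [Finset.sum_const, Finset.card_univ, Fintype.card_fin, nsmul_eq_mul]
  linarith

/-- At any time, at most about half of the coordinates are expected to be flipped. -/
theorem expect_card_flipped_le (hn : Even n) (t : ℕ) (ht : t ≤ T) :
    expect (fun k : Fin T → Fin n =>
      ((Finset.univ.filter fun i => (run a (extend k) t).flipped i).card : ℝ)) ≤ n / 2 + a := by
  classical
  have hn0 : (0 : ℝ) < n := by exact_mod_cast NeZero.pos n
  have hn1 : (1 : ℝ) ≤ n := by exact_mod_cast NeZero.pos n
  simp only [card_flipped_eq]
  induction t with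
  | zero =>
    simp only [run]
    simp only [Bool.false_eq_true, if_false, Finset.sum_const_zero, expect_const]
    positivity
  | succ t ih =>
    have hstep : expect (fun k : Fin T → Fin n =>
        ∑ i, if (run a (extend k) (t + 1)).flipped i then (1 : ℝ) else 0) ≤
        expect (fun k : Fin T → Fin n => (1 - 1 / n) *
          (∑ i, if (run a (extend k) t).flipped i then (1 : ℝ) else 0) + (1 / 2 + a / n)) := by
      refine expect_le_of_sum_update_le ⟨t, by omega⟩ fun k => ?_
      have h1 : ∀ j, ∑ i, (if (run a (extend (Function.update k ⟨t, by omega⟩ j))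
          (t + 1)).flipped i then (1 : ℝ) else 0) = _ := fun j =>
        (congrArg (fun σ : FlipState n => ∑ i, if σ.flipped i then (1 : ℝ) else 0)
          (run_update_succ (a := a) k ⟨t, by omega⟩ j)).trans (sum_next_flipped _ _ _)
      simp only [h1]
      rw [Finset.sum_add_distrib]
      have h2 := sum_flips_le (a := a) hn (extend k) t
      simp only [Finset.sum_const, Finset.card_univ, Fintype.card_fin, nsmul_eq_mul]
      have h3 : (n : ℝ) * ((1 - 1 / n) *
          (∑ i, if (run a (extend k) t).flipped i then (1 : ℝ) else 0) + (1 / 2 + a / n)) =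
          n * (∑ i, if (run a (extend k) t).flipped i then (1 : ℝ) else 0) +
            (n / 2 - (∑ i, if (run a (extend k) t).flipped i then (1 : ℝ) else 0) + a) := by
        field_simp
        ring
      rw [h3]
      linarith
    refine hstep.trans ?_
    rw [expect_add, expect_const_mul, expect_const]
    have h4 : (0 : ℝ) ≤ 1 - 1 / n := by
      rw [sub_nonneg, div_le_one hn0]
      exact hn1
    have h5 := mul_le_mul_of_nonneg_left (ih (by omega)) h4
    -- `n / 2 + a` is the fixed point of the recursion in `hstep`.
    have h6 : (1 - 1 / (n : ℝ)) * (n / 2 + a) = n / 2 + a - 1 / 2 - a / n := by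
      field_simp
      ring
    linarith

end Flipped

end SACD
-- The exponential potential for the total deviation.
namespace SACD

open FlipState

/-- By convexity the exponential lies below its chord over `[-1, 1]`. The shift `2/3`, the least
relative size of a new deviation, is what makes the constant term of the linear bound at most `1`.
-/
theorem exp_chord {y : ℝ} (h1 : -1 ≤ y) (h2 : y ≤ 1) : Real.exp (-(2 / 3) - y) ≤ 1 - 2 / 5 * y := by
  have h := convexOn_exp.2 (Set.mem_univ (1 / 3)) (Set.mem_univ (-(5 / 3)))
    (by linarith : 0 ≤ (1 - y) / 2) (by linarith : 0 ≤ (1 + y) / 2) (by ring)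
  simp only [smul_eq_mul] at h
  have e : (1 - y) / 2 * (1 / 3) + (1 + y) / 2 * -(5 / 3) = -(2 / 3) - y := by ring
  rw [e] at h
  have h3 : Real.exp (1 / 3) ≤ 7 / 5 := by
    have h4 := Real.exp_one_lt_d9
    have h5 : Real.exp (1 / 3) ^ 3 = Real.exp 1 := by rw [← Real.exp_nat_mul]; norm_num
    by_contra hc
    push Not at hc
    have := pow_lt_pow_left₀ hc (by norm_num) three_ne_zero
    norm_num at this
    linarith
  have h6 : Real.exp (-(5 / 3)) ≤ 3 / 5 := by
    have h7 : Real.exp (-(5 / 3)) ≤ Real.exp (-1) := Real.exp_le_exp.2 (by norm_num)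
    have h8 : Real.exp (-1) ≤ 3 / 5 := by linarith [Real.exp_neg_one_lt_d9]
    linarith
  nlinarith

section ErrorSum

variable {n : ℕ} {a : ℕ} {ε γ F B : ℝ} {κ : ℕ → Fin n}

/-- A new deviation points against the total, so it enlarges the total only by overshooting zero,
which the constant `2` absorbs. Only removing an old nonzero deviation can cost `ν`, and that takes
a repeated selection. -/
theorem abs_errSum_le (hn : Even n) (h : Regime ε γ F B) {t : ℕ}
    (hst : ∀ s < t, Steerable a ε γ κ F B s) :
    |errSum a ε γ κ t| ≤ (2 + repeats κ t) * nu ε γ := by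
  have hν := h.nu_pos
  induction t with
  | zero =>
    have : errSum a ε γ κ 0 = 0 :=
      Finset.sum_eq_zero fun i _ => by simp [err, deviation, memRun]
    rw [this, abs_zero]
    positivity
  | succ t ih =>
    have ih := ih fun s hs => hst s (by omega)
    have hs := stalls_of_steerable hn h (t := t) fun s hs => hst s (by omega)
    have hmono : (repeats κ t : ℝ) ≤ repeats κ (t + 1) := by
      exact_mod_cast repeats_mono κ (Nat.le_succ t)
    have h0 : (0 : ℝ) ≤ repeats κ t := Nat.cast_nonneg _
    by_cases he : IsEarly a κ t
    · have : errSum a ε γ κ (t + 1) = errSum a ε γ κ t := by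
        rw [errSum, errSum, err_succ_of_isEarly he]
      rw [this]
      exact ih.trans (mul_le_mul_of_nonneg_right (by linarith) hν.le)
    · have hb := hs.inBand hn h (hst t (by omega)) he
      rw [errSum_succ]
      have he1 := abs_le.1 (hs.abs_err_le h (κ t))
      have ih1 := abs_le.1 ih
      have hm : (2 + (repeats κ t : ℝ)) * nu ε γ ≤ (2 + repeats κ (t + 1)) * nu ε γ :=
        mul_le_mul_of_nonneg_right (by linarith) hν.le
      have h2ν : 2 * nu ε γ ≤ (2 + (repeats κ t : ℝ)) * nu ε γ :=
        mul_le_mul_of_nonneg_right (by linarith) hν.le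
      have hrep : err a ε γ κ t (κ t) = 0 ∨
          (2 + (repeats κ (t + 1) : ℝ)) * nu ε γ = (2 + repeats κ t) * nu ε γ + nu ε γ := by
        by_cases hz : err a ε γ κ t (κ t) = 0
        · exact .inl hz
        · right
          classical
          rw [repeats_succ, if_pos (exists_of_err_ne_zero hz)]
          push_cast
          ring
      rw [InBand] at hb
      rw [abs_le]
      split_ifs at hb with hY
      · rcases hrep with hz | hz
        · constructor <;> linarith
        · constructor <;> linarith
      · rcases hrep with hz | hz
        · constructor <;> linarith
        · constructor <;> linarith

/-- The potential that controls the sum of the deviations. -/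
noncomputable def potential (a : ℕ) (ε γ : ℝ) (κ : ℕ → Fin n) (t : ℕ) : ℝ :=
  Real.exp (errSum a ε γ κ t / nu ε γ) + Real.exp (-(errSum a ε γ κ t / nu ε γ))

theorem potential_pos (t : ℕ) : 0 < potential a ε γ κ t := by
  unfold potential
  positivity

theorem potential_ge (t : ℕ) : Real.exp |errSum a ε γ κ t / nu ε γ| ≤ potential a ε γ κ t := by
  rw [potential]
  have h1 := Real.exp_pos (errSum a ε γ κ t / nu ε γ)
  have h2 := Real.exp_pos (-(errSum a ε γ κ t / nu ε γ))
  rcases abs_choice (errSum a ε γ κ t / nu ε γ) with h | h <;> rw [h] <;> linarith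

theorem potential_le (t : ℕ) :
    potential a ε γ κ t ≤ 2 * Real.exp |errSum a ε γ κ t / nu ε γ| := by
  rw [potential]
  have h1 := Real.exp_le_exp.2 (le_abs_self (errSum a ε γ κ t / nu ε γ))
  have h2 := Real.exp_le_exp.2 (neg_le_abs (errSum a ε γ κ t / nu ε γ))
  linarith

/-- The `y i` are removed deviations, the `y' i` new ones. Summing the chord bound, the linear term
becomes a negative multiple of `z`, so `exp z` does not grow on average; the other exponential is at
most `exp 2` because `z - y i + y' i ≥ -2`. -/
theorem sum_exp_add_exp_le {ι : Type*} [Fintype ι] {z : ℝ} {y : ι → ℝ} (hz : z = ∑ i, y i)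
    (hz0 : 0 ≤ z) (hy : ∀ i, |y i| ≤ 1) (y' : ι → ℝ) (hy' : ∀ i, -1 ≤ y' i ∧ y' i ≤ -(2 / 3)) :
    ∑ i, (Real.exp (z - y i + y' i) + Real.exp (-(z - y i + y' i))) ≤
      Fintype.card ι * (Real.exp z + Real.exp (-z) + Real.exp 2) := by
  have h1 : ∀ i, Real.exp (z - y i + y' i) + Real.exp (-(z - y i + y' i)) ≤
      (Real.exp z - 2 / 5 * Real.exp z * y i) + Real.exp 2 := by
    intro i
    obtain ⟨h2, h3⟩ := abs_le.1 (hy i)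
    have h4 : Real.exp (z - y i + y' i) ≤ Real.exp z * Real.exp (-(2 / 3) - y i) := by
      rw [← Real.exp_add]
      exact Real.exp_le_exp.2 (by linarith [(hy' i).2])
    have h5 := mul_le_mul_of_nonneg_left (exp_chord h2 h3) (Real.exp_pos z).le
    have h6 : Real.exp (-(z - y i + y' i)) ≤ Real.exp 2 :=
      Real.exp_le_exp.2 (by linarith [(hy' i).1])
    linarith
  refine (Finset.sum_le_sum fun i _ => h1 i).trans ?_
  rw [Finset.sum_add_distrib, Finset.sum_sub_distrib, ← Finset.mul_sum, ← hz]
  simp only [Finset.sum_const, Finset.card_univ, nsmul_eq_mul]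
  have h7 : 0 ≤ 2 / 5 * Real.exp z * z := by positivity
  have h8 : 0 ≤ (Fintype.card ι : ℝ) * Real.exp (-z) := by positivity
  linarith

variable [NeZero n] {T : ℕ}

theorem sum_potential_update_le (hn : Even n) (h : Regime ε γ F B) (k : Fin T → Fin n) (t : Fin T)
    (hat : a ≤ t) (hs : Stalls a ε γ (extend k) t) (hst : Steerable a ε γ (extend k) F B t) :
    ∑ j, potential a ε γ (extend (Function.update k t j)) (t + 1) ≤
      n * (potential a ε γ (extend k) t + Real.exp 2) := by
  have hν := h.nu_pos
  -- For `a ≤ t` the state before update `t` depends only on earlier selections, so the selection at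
  -- `t` can be averaged. For `t < a` this fails, as the targets depend on all of the first `a`
  -- selections.
  have hc : ∀ j, ∀ s < max (t : ℕ) a, extend (Function.update k t j) s = extend k s :=
    fun j s hs => extend_update_of_lt k t j (by omega)
  have hs' : ∀ j, Stalls a ε γ (extend (Function.update k t j)) t := by
    intro j
    constructor
    · rw [err_congr (hc j)]
      exact hs.err
    · rw [run_congr (hc j), memRun_congr (hc j)]
      exact hs.old
  have hb : ∀ j, InBand (nu ε γ) (errSum a ε γ (extend k) t)
      (err a ε γ (extend (Function.update k t j)) (t + 1) j) := by
    intro j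
    have := (hs' j).inBand hn h ((steerable_congr (hc j)).2 hst)
      (fun he => by have := he.1; omega)
    rwa [errSum_congr (hc j), extend_update_self] at this
  have hsum : ∀ j, errSum a ε γ (extend (Function.update k t j)) (t + 1) =
      errSum a ε γ (extend k) t - err a ε γ (extend k) t j +
        err a ε γ (extend (Function.update k t j)) (t + 1) j := by
    intro j
    rw [errSum_succ, extend_update_self, errSum_congr (hc j), err_congr (hc j)]
  set e := err a ε γ (extend k) t
  set e' := fun j => err a ε γ (extend (Function.update k t j)) (t + 1) j
  set z := errSum a ε γ (extend k) t / nu ε γ with hz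
  have hzs : z = ∑ i, e i / nu ε γ := by rw [hz, errSum, Finset.sum_div]
  have hy : ∀ i, |e i / nu ε γ| ≤ 1 := by
    intro i
    rw [abs_div, abs_of_pos hν, div_le_one hν]
    exact hs.abs_err_le h i
  have hpot : ∀ j, potential a ε γ (extend (Function.update k t j)) (t + 1) =
      Real.exp (z - e j / nu ε γ + e' j / nu ε γ) +
        Real.exp (-(z - e j / nu ε γ + e' j / nu ε γ)) := by
    intro j
    have : errSum a ε γ (extend (Function.update k t j)) (t + 1) / nu ε γ =
        z - e j / nu ε γ + e' j / nu ε γ := by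
      rw [hsum, add_div, sub_div]
    rw [potential, this]
  simp only [hpot]
  have hp : potential a ε γ (extend k) t = Real.exp z + Real.exp (-z) := rfl
  rw [hp]
  by_cases hY : 0 ≤ errSum a ε γ (extend k) t
  · have := sum_exp_add_exp_le hzs (div_nonneg hY hν.le) hy (fun j => e' j / nu ε γ) fun j => by
      have := hb j
      rw [InBand, if_pos hY] at this
      constructor
      · rw [le_div_iff₀ hν]
        linarith [this.1]
      · rw [div_le_iff₀ hν]
        linarith [this.2]
    rwa [Fintype.card_fin] at this
  · have hz0 : 0 ≤ -z := by
      rw [hz, ← neg_div]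
      exact div_nonneg (by linarith) hν.le
    have := sum_exp_add_exp_le (y := fun i => -(e i / nu ε γ)) (z := -z)
      (by rw [hzs, Finset.sum_neg_distrib]) hz0 (fun i => by rw [abs_neg]; exact hy i)
      (fun j => -(e' j / nu ε γ)) fun j => by
        have := hb j
        rw [InBand, if_neg hY] at this
        constructor
        · rw [neg_le_neg_iff, div_le_iff₀ hν]
          linarith [this.2]
        · rw [neg_le_neg_iff, le_div_iff₀ hν]
          linarith [this.1]
    rw [Fintype.card_fin, neg_neg] at this
    refine (Finset.sum_le_sum fun j _ => ?_).trans (this.trans_eq (by ring))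
    rw [add_comm]
    apply le_of_eq
    congr 2 <;> ring

-- Runs that have already failed are cut off, since the drift estimate needs steered deviations. The
-- initial value at time `a` comes from the bound by repeated selections.
open Classical in
theorem expect_potential_le (hn : Even n) (h : Regime ε γ F B) (haT : a ≤ T) {m : ℕ}
    (hm : a + m ≤ T) :
    expect (fun k : Fin T → Fin n =>
      if ∀ s < a + m, Steerable a ε γ (extend k) F B s then potential a ε γ (extend k) (a + m)
        else 0) ≤
      2 * Real.exp 2 * Real.exp (2 * a / n * a) + m * Real.exp 2 := by
  have hν := h.nu_pos
  induction m with
  | zero =>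
    rw [Nat.cast_zero, zero_mul, add_zero, add_zero]
    refine le_trans ?_ (mul_le_mul_of_nonneg_left (expect_exp_repeats_le (n := n) a haT)
      (by positivity))
    rw [← expect_const_mul]
    refine expect_mono fun k => ?_
    split_ifs with hk
    · refine (potential_le _).trans ?_
      rw [mul_assoc, ← Real.exp_add]
      refine mul_le_mul_of_nonneg_left (Real.exp_le_exp.2 ?_) zero_le_two
      rw [abs_div, abs_of_pos hν, div_le_iff₀ hν]
      exact abs_errSum_le hn h hk
    · positivity
  | succ m ih =>
    have ih := ih (by omega)
    have hstep : expect (fun k : Fin T → Fin n =>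
        if ∀ s < a + (m + 1), Steerable a ε γ (extend k) F B s then
          potential a ε γ (extend k) (a + (m + 1)) else 0) ≤
        expect (fun k : Fin T → Fin n =>
          (if ∀ s < a + m, Steerable a ε γ (extend k) F B s then
            potential a ε γ (extend k) (a + m) else 0) + Real.exp 2) := by
      refine expect_le_of_sum_update_le ⟨a + m, by omega⟩ fun k => ?_
      have hok : ∀ j, (∀ s < a + (m + 1), Steerable a ε γ
          (extend (Function.update k ⟨a + m, by omega⟩ j)) F B s) ↔
          ∀ s < a + (m + 1), Steerable a ε γ (extend k) F B s := by
        intro j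
        refine forall₂_congr fun s hs => steerable_congr fun s' hs' => ?_
        exact extend_update_of_lt k ⟨a + m, by omega⟩ j (show s' < a + m by omega)
      simp only [hok]
      split_ifs with h1 h2
      · exact sum_potential_update_le hn h k ⟨a + m, by omega⟩ (by simp)
          (stalls_of_steerable hn h h2) (h1 _ (show a + m < a + (m + 1) by omega))
      · exact absurd (fun s hs => h1 s (by omega)) h2
      · rw [Finset.sum_const_zero]
        have := potential_pos (a := a) (ε := ε) (γ := γ) (κ := extend k) (a + m)
        positivity
      · rw [Finset.sum_const_zero]
        positivity
    refine hstep.trans ?_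
    rw [expect_add, expect_const]
    push_cast
    linarith

/-- Too few flips are excluded by `prob_count_lt_le`; a large total deviation by Markov's
inequality, applied to `exp (repeats)` for `t < a` and to the potential afterwards. -/
theorem prob_not_steerable_le (hn : Even n) (h : Regime ε γ F B) (haT : a ≤ T) {t : ℕ}
    (ht : t < T) :
    prob (fun k : Fin T → Fin n => (∀ s < t, Steerable a ε γ (extend k) F B s) ∧
      ¬Steerable a ε γ (extend k) F B t) ≤ Real.exp (F / 2) * flipRate n a ^ a +
        Real.exp (2 - B) * (2 * Real.exp (2 * a / n * a) + T) := by
  classical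
  have hν := h.nu_pos
  have h1 : prob (fun k : Fin T → Fin n => (∀ s < t, Steerable a ε γ (extend k) F B s) ∧
      ¬Steerable a ε γ (extend k) F B t) ≤ prob (fun k : Fin T → Fin n =>
      ¬((run a (extend k) (max t a - a)).count + F ≤ (run a (extend k) (max t a)).count) ∨
      ((∀ s < t, Steerable a ε γ (extend k) F B s) ∧ B * nu ε γ < |errSum a ε γ (extend k) t|)) := by
    refine prob_mono fun k hk => ?_
    obtain ⟨hk1, hk2⟩ := hk
    rw [Steerable, not_and_or, not_le (a := |_|)] at hk2
    exact hk2.imp id fun h => ⟨hk1, h⟩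
  refine (h1.trans (prob_or_le _ _)).trans (add_le_add
    (prob_count_lt_le hn F (le_max_right t a) (by omega)) ?_)
  rcases Nat.lt_or_ge t a with hta | hta
  · have h2 : prob (fun k : Fin T → Fin n => (∀ s < t, Steerable a ε γ (extend k) F B s) ∧
        B * nu ε γ < |errSum a ε γ (extend k) t|) ≤
        Real.exp (2 - B) * Real.exp (2 * a / n * a) := by
      refine le_trans ?_ (mul_le_mul_of_nonneg_left (expect_exp_repeats_le (n := n) a haT)
        (Real.exp_pos _).le)
      rw [← expect_const_mul]
      refine prob_le_expect (fun k => by positivity) fun k hk => ?_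
      have h3 := lt_of_mul_lt_mul_right (hk.2.trans_le (abs_errSum_le hn h hk.1)) hν.le
      have h4 : (repeats (extend k) t : ℝ) ≤ repeats (extend k) a := by
        exact_mod_cast repeats_mono (extend k) hta.le
      rw [← Real.exp_add, Real.one_le_exp_iff]
      linarith
    refine h2.trans (mul_le_mul_of_nonneg_left ?_ (Real.exp_pos _).le)
    have := Real.exp_pos (2 * a / n * a : ℝ)
    have : (0 : ℝ) ≤ T := Nat.cast_nonneg _
    linarith
  · obtain ⟨m, rfl⟩ := Nat.exists_eq_add_of_le hta
    have h2 : prob (fun k : Fin T → Fin n => (∀ s < a + m, Steerable a ε γ (extend k) F B s) ∧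
        B * nu ε γ < |errSum a ε γ (extend k) (a + m)|) ≤
        Real.exp (-B) * (2 * Real.exp 2 * Real.exp (2 * a / n * a) + m * Real.exp 2) := by
      refine le_trans ?_ (mul_le_mul_of_nonneg_left (expect_potential_le hn h haT ht.le)
        (Real.exp_pos _).le)
      rw [← expect_const_mul]
      refine prob_le_expect (fun k => ?_) fun k hk => ?_
      · split_ifs
        · exact (mul_pos (Real.exp_pos _) (potential_pos _)).le
        · rw [mul_zero]
      · rw [if_pos hk.1]
        refine le_trans ?_ (mul_le_mul_of_nonneg_left (potential_ge _) (Real.exp_pos _).le)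
        rw [← Real.exp_add, Real.one_le_exp_iff, abs_div, abs_of_pos hν]
        have := (lt_div_iff₀ hν).2 hk.2
        linarith
    refine h2.trans ?_
    have h3 : Real.exp (2 - B) = Real.exp (-B) * Real.exp 2 := by rw [← Real.exp_add]; ring_nf
    have h4 : (m : ℝ) ≤ T := by exact_mod_cast (by omega : m ≤ T)
    have h5 := mul_le_mul_of_nonneg_left h4 (Real.exp_pos (2 - B)).le
    rw [h3] at h5 ⊢
    linarith

/-- All updates can be steered, with high probability. -/
theorem prob_exists_not_steerable_le (hn : Even n) (h : Regime ε γ F B) (haT : a ≤ T) :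
    prob (fun k : Fin T → Fin n => ¬∀ s < T, Steerable a ε γ (extend k) F B s) ≤
      T * (Real.exp (F / 2) * flipRate n a ^ a +
        Real.exp (2 - B) * (2 * Real.exp (2 * a / n * a) + T)) := by
  refine le_trans (prob_mono fun k hk => ?_) (prob_exists_lt_le (fun t k =>
    (∀ s < t, Steerable a ε γ (extend k) F B s) ∧ ¬Steerable a ε γ (extend k) F B t) T
    fun t ht => prob_not_steerable_le hn h haT ht)
  classical
  push Not at hk
  -- The union bound runs over the first failure, so that all previous updates were steered.
  refine ⟨Nat.find hk, (Nat.find_spec hk).1, fun s hs => ?_, (Nat.find_spec hk).2⟩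
  have := Nat.find_min hk hs
  have hsT := hs.trans (Nat.find_spec hk).1
  tauto

end ErrorSum

end SACD
-- Numerical constants and the main theorem.
namespace SACD

theorem alpha_ge {ε γ : ℝ} (hε : ε ≤ 1 / 18) (hγ : 1 ≤ γ) : 17 * (ε / γ) ≤ alpha ε γ := by
  rw [alpha, ← mul_div_assoc]
  exact div_le_div_of_nonneg_right (by linarith) (by linarith)

/-- With `u = ε / γ`, the part `B` of `F` pays for `u B ν`, as `4ν ≤ α`. The part `7 / u` leaves `9ν
≤ α (3/2 + α - u)`, which follows from `ν = 3uα / (1 - 6u)`, `α ≥ 17u` and `u ≤ 1/18`. -/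
theorem regime {ε γ B : ℝ} (hε0 : 0 < ε) (hε : ε ≤ 1 / 18) (hγ : 1 ≤ γ) (hB : 0 ≤ B) :
    Regime ε γ (7 * (γ / ε) + B + 3) B where
  pos := hε0
  le := hε
  one_le := hγ
  range := by
    have hγ0 : 0 < γ := by linarith
    have hd : 0 < γ - 6 * ε := by linarith
    have hα : 0 < alpha ε γ := div_pos (by linarith) hγ0
    have hαu := alpha_ge hε hγ
    have hν : nu ε γ * (γ - 6 * ε) = 3 * ε * alpha ε γ := div_mul_cancel₀ _ hd.ne'
    have hν4 : nu ε γ ≤ alpha ε γ / 4 := by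
      rw [nu, div_le_iff₀ hd]
      nlinarith
    have hu0 : 0 < ε / γ := div_pos hε0 hγ0
    have hu : ε / γ ≤ 1 / 18 := (div_le_self hε0.le hγ).trans hε
    have hinv : γ / ε * (ε / γ) = 1 := by field_simp
    have hν' : nu ε γ * (1 - 6 * (ε / γ)) = 3 * (ε / γ) * alpha ε γ := by
      field_simp
      linarith
    generalize alpha ε γ = α at *
    generalize nu ε γ = ν at *
    generalize ε / γ = u at *
    generalize γ / ε = v at *
    have h1 : (7 * v + B + 3 - 3) / 2 * (u * (α - 2 * ν)) = (7 + u * B) / 2 * (α - 2 * ν) := by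
      linear_combination 7 / 2 * (α - 2 * ν) * hinv
    rw [h1]
    have h2 : 0 ≤ u * B * (α - 4 * ν) := mul_nonneg (mul_nonneg hu0.le hB) (by linarith)
    have h3 : 9 * ν ≤ α * (3 / 2 + α - u) := by
      have h6 : 0 < 1 - 6 * u := by linarith
      refine le_of_mul_le_mul_right ?_ h6
      have h4 : 27 * u ≤ (3 / 2 + 16 * u) * (1 - 6 * u) := by nlinarith
      have h5 : (3 / 2 + 16 * u) * (1 - 6 * u) ≤ (3 / 2 + α - u) * (1 - 6 * u) :=
        mul_le_mul_of_nonneg_right (by linarith) h6.le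
      have h7 := mul_le_mul_of_nonneg_left (h4.trans h5) hα.le
      linarith
    linarith

theorem flipRate_le {n a : ℕ} (h : (a : ℝ) / n ≤ 1 / 666) : flipRate n a ≤ Real.exp (-(21 / 100)) := by
  have h1 : Real.exp (-(1 / 2)) ≤ 6066 / 10000 := by
    have h2 := Real.exp_neg_one_lt_d9
    have h3 : Real.exp (-(1 / 2)) ^ 2 = Real.exp (-1) := by
      rw [← Real.exp_nat_mul]
      norm_num
    by_contra hc
    push Not at hc
    have := pow_lt_pow_left₀ hc (by norm_num) two_ne_zero
    norm_num at this h2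
    linarith
  have h4 : (379 / 400 : ℝ) ^ 4 ≤ Real.exp (-(21 / 100)) := by
    have h5 := Real.add_one_le_exp (-(21 / 400) : ℝ)
    have h6 : Real.exp (-(21 / 400)) ^ 4 = Real.exp (-(21 / 100)) := by
      rw [← Real.exp_nat_mul]
      norm_num
    rw [← h6]
    exact pow_le_pow_left₀ (by norm_num) (by linarith) 4
  refine le_trans ?_ h4
  rw [flipRate]
  have h7 : (3934 / 10000 : ℝ) * (1 / 2 - 1 / 666) ≤ (1 - Real.exp (-(1 / 2))) * (1 / 2 - a / n) :=
    mul_le_mul (by linarith) (by linarith) (by norm_num) (by linarith)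
  norm_num at h7 ⊢
  linarith

/-- The failure probability, for `N = n ^ c` and `T = ⌈N⌉`. -/
theorem failure_le {n a : ℕ} {N T L R F : ℝ} (hL : 0 ≤ L) (hR : 0 ≤ R) (hN : N = Real.exp L)
    (hN5 : 5 ≤ N) (hT0 : 0 ≤ T) (hT : T ≤ 2 * N) (ha : 37 / 2 * R + 24 * L + 108 ≤ a)
    (haN : (a : ℝ) / n ≤ 1 / 666) (ha2 : (2 * a / n * a : ℝ) ≤ 1 / 2)
    (hF : F ≤ 7 * (1002 / 1000 * R) + (3 * L + 6) + 3) :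
    T * (Real.exp (F / 2) * flipRate n a ^ a +
      Real.exp (2 - (3 * L + 6)) * (2 * Real.exp (2 * a / n * a) + T)) ≤ 1 / N := by
  have hN0 : 0 < N := by linarith
  have h1 : Real.exp (F / 2) * flipRate n a ^ a ≤ Real.exp (-4) * Real.exp (-(3 * L)) := by
    calc Real.exp (F / 2) * flipRate n a ^ a
        ≤ Real.exp (F / 2) * Real.exp (-(21 / 100)) ^ a :=
          mul_le_mul_of_nonneg_left (pow_le_pow_left₀ (flipRate_nonneg n a) (flipRate_le haN) a)
            (Real.exp_pos _).le
      _ = Real.exp (F / 2 + a * -(21 / 100)) := by rw [← Real.exp_nat_mul, Real.exp_add]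
      -- `0.21 · 37/2` exceeds half of `7 · 1.002`, so the terms in `R` are absorbed; `24 L + 108`
      -- supplies the rest.
      _ ≤ Real.exp (-4 + -(3 * L)) := Real.exp_le_exp.2 (by linarith)
      _ = _ := Real.exp_add _ _
  have h2 : Real.exp (2 - (3 * L + 6)) = Real.exp (-4) * Real.exp (-(3 * L)) := by
    rw [← Real.exp_add]
    ring_nf
  have h3 : Real.exp (-(3 * L)) = 1 / N ^ 3 := by
    rw [hN, ← Real.exp_nat_mul, Real.exp_neg, one_div]
    norm_num
  have h4 : Real.exp (-4) ≤ 1 / 16 := by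
    have h5 : Real.exp (-1) ≤ 1 / 2 := by linarith [Real.exp_neg_one_lt_d9]
    have h6 : Real.exp (-1) ^ 4 = Real.exp (-4) := by
      rw [← Real.exp_nat_mul]
      norm_num
    rw [← h6]
    refine (pow_le_pow_left₀ (Real.exp_pos _).le h5 4).trans ?_
    norm_num
  have h7 : Real.exp (2 * a / n * a : ℝ) ≤ 2 := by
    have h8 : Real.exp (1 / 2) ^ 2 = Real.exp 1 := by
      rw [← Real.exp_nat_mul]
      norm_num
    have h9 : Real.exp (1 / 2) ≤ 2 := by
      by_contra hc
      push Not at hc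
      have := pow_lt_pow_left₀ hc (by norm_num) two_ne_zero
      linarith [Real.exp_one_lt_d9]
    exact (Real.exp_le_exp.2 ha2).trans h9
  rw [h2]
  have h8 : 0 < Real.exp (-4) * Real.exp (-(3 * L)) := by positivity
  calc T * (Real.exp (F / 2) * flipRate n a ^ a + Real.exp (-4) * Real.exp (-(3 * L)) *
        (2 * Real.exp (2 * a / n * a) + T))
      ≤ T * (Real.exp (-4) * Real.exp (-(3 * L)) * (5 + T)) := by
        refine mul_le_mul_of_nonneg_left ?_ hT0
        have := mul_le_mul_of_nonneg_left h7 h8.le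
        linarith
    _ ≤ (2 * N) * (1 / 16 * (1 / N ^ 3) * (3 * N)) := by
        rw [h3]
        have h9 : (0 : ℝ) ≤ 1 / N ^ 3 := by positivity
        refine mul_le_mul hT (mul_le_mul (mul_le_mul_of_nonneg_right h4 h9) (by linarith)
          (by linarith) (by positivity)) ?_ (by linarith)
        have := Real.exp_pos (-4)
        positivity
    _ = 6 / 16 * (1 / N) := by field_simp; norm_num
    _ ≤ 1 / N := by
        have : 0 < 1 / N := by positivity
        linarith

end SACD

set_option maxHeartbeats 400000 in
open SACD in
theorem theorem3
    (c : ℝ) (hc : 1 ≤ c)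
    (n : ℕ) (hn : Even n)
    (Lmax Lresbar Γ : ℝ) (hLmax : 0 < Lmax) (hΓ : Lmax ≤ Γ)
    (qbar : ℕ)
    (hqbar : qbar = ⌈74 * Γ * √(n : ℝ) / Lresbar + 96 * c * Real.log n + 435⌉₊)
    (hnq : (qbar : ℝ) ^ 2 / 4 ≤ n)
    (hlow : 37 / 2 * (Γ / Lmax) < Lresbar / Lmax)
    (hhigh : Lresbar / Lmax ≤ 1 / 18 * √((n : ℝ) - 1))
    (ε : ℝ) (hε : ε = √(((Lresbar / Lmax) ^ 2 - 1) / ((n : ℝ) - 1)))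
    (q : ℕ) (hq : qbar ≤ q) :
    SACD.lipMax (fun x : Fin n → ℝ => Lmax * SACD.fEps ε x) = Lmax ∧
    SACD.lipResBar (fun x : Fin n → ℝ => Lmax * SACD.fEps ε x) = Lresbar ∧
    ∃ S : SACD.Schedule n ⌈(n : ℝ) ^ c⌉₊,
      S.IsBounded q ∧
      1 - 1 / (n : ℝ) ^ c ≤
        SACD.prob (fun k => SACD.StallsFor S ε Lmax Γ k ⌈(n : ℝ) ^ c⌉₊) ∧
      ∀ t : ℕ, (t : ℝ) ≤ (n : ℝ) ^ c →
        1 / 4 * (SACD.fEps ε (SACD.startPoint n) - SACD.minValue (SACD.fEps (n := n) ε)) ≤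
          SACD.expect (fun k =>
            SACD.fEps ε (S.point (fun x => Lmax * SACD.fEps ε x) Γ (SACD.startPoint n) k t) -
              SACD.minValue (SACD.fEps (n := n) ε)) := by
  classical
  set γ := Γ / Lmax with hγdef
  set res := Lresbar / Lmax with hres
  have hγ : 1 ≤ γ := (one_le_div hLmax).2 hΓ
  have hγ0 : 0 < γ := by linarith
  have hres18 : 37 / 2 < res := by linarith
  have hres0 : 0 < res := by linarith
  -- `333 = 18 · 37/2`, from combining both bounds on `res`.
  have hsqrt : 333 < √((n : ℝ) - 1) := by linarith
  have hn1pos : 0 < (n : ℝ) - 1 := by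
    by_contra hneg
    rw [Real.sqrt_eq_zero_of_nonpos (by linarith)] at hsqrt
    norm_num at hsqrt
  have hsq : √((n : ℝ) - 1) ^ 2 = n - 1 := Real.sq_sqrt hn1pos.le
  have hnbig : (110889 : ℝ) < n := by
    have := pow_lt_pow_left₀ hsqrt (by norm_num) two_ne_zero
    norm_num [hsq] at this
    linarith
  have hn0 : 0 < n := by
    have : (0 : ℝ) < n := by linarith
    exact_mod_cast this
  have : NeZero n := ⟨hn0.ne'⟩
  have hnR : (0 : ℝ) < n := by exact_mod_cast hn0
  have hres342 : 342 ≤ res ^ 2 := by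
    have := pow_le_pow_left₀ (by norm_num) hres18.le 2
    norm_num at this
    linarith
  have hres2 : res ^ 2 ≤ (n - 1) / 324 := by
    have := pow_le_pow_left₀ hres0.le hhigh 2
    rw [mul_pow, hsq] at this
    linarith
  have hquot0 : 0 < (res ^ 2 - 1) / ((n : ℝ) - 1) := div_pos (by linarith) hn1pos
  have hε0 : 0 < ε := hε ▸ Real.sqrt_pos.2 hquot0
  have hεsq : ε ^ 2 = (res ^ 2 - 1) / (n - 1) := by rw [hε, Real.sq_sqrt hquot0.le]
  have hεn : ((n : ℝ) - 1) * ε ^ 2 = res ^ 2 - 1 := by rw [hεsq]; field_simp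
  have hε18 : ε ≤ 1 / 18 := by
    have h1 : ε ^ 2 ≤ (1 / 18) ^ 2 := by
      rw [hεsq, div_le_iff₀ hn1pos]
      linarith
    exact (sq_le_sq₀ hε0.le (by norm_num)).1 h1
  have hLres : Lresbar = Lmax * res := by rw [hres]; field_simp
  refine ⟨lipMax_mul_fEps _ _ hLmax.le hε0.le, ?_, ?_⟩
  · rw [lipResBar_mul_fEps _ _ hLmax.le hε0.le, hεn, hLres]
    congr 1
    rw [add_sub_cancel, Real.sqrt_sq hres0.le]
  set R := Γ * √(n : ℝ) / Lresbar with hR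
  set L := c * Real.log n with hL
  have hlog : 0 ≤ Real.log n := Real.log_nonneg (by linarith)
  have hL0 : 0 ≤ L := mul_nonneg (by linarith) hlog
  have hReq : R = γ * √(n : ℝ) / res := by
    rw [hR, hLres, hγdef]
    field_simp
  have hR0 : 0 ≤ R := by rw [hReq]; positivity
  -- `res²` exceeds `(n - 1) ε²` only by `1`, a small relative error because `res² ≥ 342`.
  have hγε : γ / ε ≤ 1002 / 1000 * R := by
    rw [hReq, div_le_iff₀ hε0]
    have h1 : res ≤ 1002 / 1000 * (√(n : ℝ) * ε) := by
      refine (sq_le_sq₀ hres0.le (by positivity)).1 ?_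
      rw [mul_pow, mul_pow, Real.sq_sqrt hnR.le]
      linarith [sq_nonneg ε]
    have h2 : 1002 / 1000 * (γ * √(n : ℝ) / res) * ε =
        γ * (1002 / 1000 * (√(n : ℝ) * ε)) / res := by ring
    rw [h2, le_div_iff₀ hres0]
    exact mul_le_mul_of_nonneg_left h1 hγ0.le
  set N := (n : ℝ) ^ c with hNdef
  have hNexp : N = Real.exp L := by
    rw [hNdef, Real.rpow_def_of_pos hnR, mul_comm]
  have hnN : (n : ℝ) ≤ N := by
    have := Real.rpow_le_rpow_of_exponent_le (by linarith : (1 : ℝ) ≤ n) hc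
    rwa [Real.rpow_one] at this
  have hN0 : 0 < N := by linarith
  set T := ⌈N⌉₊ with hT
  have hTN : (T : ℝ) < N + 1 := Nat.ceil_lt_add_one hN0.le
  have hNT : N ≤ T := Nat.le_ceil N
  -- The schedule is `4a`-bounded. Rounding loses at most `3`, whence `435 = 4 · 108 + 3`.
  obtain ⟨a, ha⟩ : ∃ a, a = qbar / 4 := ⟨_, rfl⟩
  have h4a : 4 * a ≤ qbar := by omega
  have hqa : qbar ≤ 4 * a + 3 := by omega
  have h4aR : 4 * (a : ℝ) ≤ qbar := by exact_mod_cast h4a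
  have hqaR : (qbar : ℝ) ≤ 4 * a + 3 := by exact_mod_cast hqa
  have hqR : 74 * R + 96 * L + 435 ≤ qbar := by
    rw [hqbar]
    refine le_trans (le_of_eq ?_) (Nat.le_ceil _)
    rw [hR, hL]
    ring
  have haR : 37 / 2 * R + 24 * L + 108 ≤ a := by linarith
  have ha0 : (0 : ℝ) ≤ a := Nat.cast_nonneg a
  have ha2 : 4 * (a : ℝ) ^ 2 ≤ n := by
    have := pow_le_pow_left₀ (by positivity) h4aR 2
    linarith
  have ha666 : 666 * (a : ℝ) ≤ n := by
    have := sq_nonneg (2 * (a : ℝ) - 333)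
    linarith
  have haT : a ≤ T := by
    have : (a : ℝ) ≤ T := by linarith
    exact_mod_cast this
  have hreg : Regime ε (Γ / Lmax) (7 * (γ / ε) + (3 * L + 6) + 3) (3 * L + 6) :=
    regime hε0 hε18 hγ (by linarith)
  have haN : (a : ℝ) / n ≤ 1 / 666 := by
    rw [div_le_div_iff₀ hnR (by norm_num)]
    linarith
  have hfail := (prob_exists_not_steerable_le (n := n) (T := T) hn hreg haT).trans
    (failure_le (R := R) hL0 hR0 hNexp (by linarith) (Nat.cast_nonneg T) (by linarith) haR haN
      (by
        rw [div_mul_eq_mul_div, div_le_iff₀ hnR]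
        linarith) (by linarith))
  refine ⟨stallingSchedule n T a ε (Γ / Lmax), isBounded_stallingSchedule (h4a.trans hq), ?_, ?_⟩
  · have h1 := prob_not (fun k : Fin T → Fin n => ∀ s < T,
      Steerable a ε (Γ / Lmax) (extend k) (7 * (γ / ε) + (3 * L + 6) + 3) (3 * L + 6) s)
    refine le_trans (by linarith) (prob_mono fun k hk =>
      stallsFor_stallingSchedule k hn hLmax.ne' haT hreg hk)
  · intro t ht
    have htT : t ≤ T := by
      have : (t : ℝ) ≤ T := ht.trans hNT
      exact_mod_cast this
    rw [minValue_fEps hε0.le (by linarith), fEps_startPoint hn]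
    simp only [sub_zero]
    obtain ⟨A, hA, hfail⟩ : ∃ A : (Fin T → Fin n) → Prop, (∀ k, ¬A k → ∀ s < T,
        Steerable a ε (Γ / Lmax) (extend k) (7 * (γ / ε) + (3 * L + 6) + 3) (3 * L + 6) s) ∧
        prob A ≤ 1 / N :=
      ⟨_, fun _ => not_not.1, hfail⟩
    set φ : (Fin T → Fin n) → ℝ := fun k =>
      ((Finset.univ.filter fun i => (FlipState.run a (extend k) t).flipped i).card : ℝ)
    have hφ : expect φ ≤ n / 2 + a := expect_card_flipped_le hn t htT
    set C := (1 - ε) / 2 * (9 / 16) with hC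
    have hC0 : 0 ≤ C := mul_nonneg (by linarith) (by norm_num)
    -- On the failure event `A` only `f_ε ≥ 0` is used; the term `-(C * n)` then makes the left side
    -- nonpositive, and costs at most `C` in expectation as `prob A ≤ 1 / N ≤ 1 / n`.
    have hpt : ∀ k : Fin T → Fin n,
        C * (n - a) + (-C * φ k + -(C * n) * (if A k then 1 else 0)) ≤
        fEps ε ((stallingSchedule n T a ε (Γ / Lmax)).point (fun x => Lmax * fEps ε x) Γ
          (startPoint n) k t) := by
      intro k
      have hφ0 : 0 ≤ φ k := Nat.cast_nonneg _
      by_cases hk : A k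
      · rw [if_pos hk]
        refine le_trans ?_ (fEps_nonneg hε0.le (by linarith) _)
        have h1 := mul_nonneg hC0 hφ0
        have h2 := mul_nonneg hC0 ha0
        linarith
      · rw [if_neg hk]
        refine le_trans (le_of_eq ?_) (fEps_point_ge k hn hLmax.ne' haT hreg (hA k hk) htT)
        rw [hC]
        ring
    refine le_trans ?_ (expect_mono hpt)
    rw [expect_add, expect_add, expect_const, expect_const_mul, expect_const_mul,
      ← prob_eq_expect]
    have h1 := mul_le_mul_of_nonneg_left hφ hC0
    have h2 : C * (n * prob A) ≤ C * 1 := by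
      refine mul_le_mul_of_nonneg_left ?_ hC0
      have h3 : n * prob A ≤ n * (1 / N) := mul_le_mul_of_nonneg_left hfail hnR.le
      have h4 : n * (1 / N) ≤ 1 := by
        rw [mul_one_div, div_le_one hN0]
        exact hnN
      linarith
    -- Half of `9/16` exceeds `1/4` by `1/32`, which covers the lower-order terms since `666 a ≤ n`.
    have h5 : 1 / 4 * ((1 - ε) / 2 * n) ≤ C * (n / 2 - 2 * a - 1) := by
      have h6 : 1 / 4 * ((1 - ε) / 2 * n) = (1 - ε) / 2 * (n / 4) := by ring
      rw [h6, hC, mul_assoc]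
      exact mul_le_mul_of_nonneg_left (by linarith) (by linarith)
    linarith
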